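/- Let $A$ be a finite alphabet and let $X=(X_i)_{i\in\mathbb Z}$ be a stationary $A$-valued process on a probability space $(\Omega,\mathcal F,\mathbf P)$, with law $\nu$ on $A^{\mathbb Z}$. Write $a_m^n=(a_m,\dots,a_n)$ and let $\nu_k(a_1^k)=\mathbf P(X_1^k=a_1^k)$ be the $k$-marginal, $\nu_{k+1}(a_0|a_{-k}^{-1})=\mathbf P(X_0=a_0\mid X_{-k}^{-1}=a_{-k}^{-1})$ for $k\ge 1$, and $\nu_1(a_0|a_0^{-1})=\nu_1(a_0)$ for $k=0$. For a probability $\mu$ on $A^k$ let $H(\mu)=-\sum_{a\in A^k}\mu(a)\log\mu(a)$, and put $H_k=H(\nu_k)$, $h_k=-\sum_{a_{-k}^0}\nu_{k+1}(a_{-k}^0)\log\nu_{k+1}(a_0|a_{-k}^{-1})$ for $k\ge 0$, and $h=\lim_k H_k/k=\lim_k h_k$. For $k\le n$ let $\hat\nu_{k,n}(a_1^k)=\frac1{n-k+1}\sum_{i=1}^{n-k+1}\mathbf 1(X_i^{i+k-1}=a_1^k)$ be the empirical $k$-distribution of the sample $X_1^n$, and let $\hat H_{k,n}=H(\hat\nu_{k,n})$.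 Assume: (A) $\nu_n(a_1^n)>0$ for every $n$ and every $a_1^n\in A^n$. (B) The limit $\nu(a_0|a_{-\infty}^{-1}):=\lim_{m\to\infty}\nu_{m+1}(a_0|a_{-m}^{-1})$ exists for every history $a_{-\infty}^0$. (C) There is a sequence $\gamma_m\searrow 0$ such that, for every $m\ge 0$, $\gamma_m=\sup\left|\frac{\nu(a_0|a_{-\infty}^{-1})}{\nu(b_0|b_{-\infty}^{-1})}-1\right|$, the supremum being over all pairs of histories $a,b$ with $a_i=b_i$ for $i=0,-1,\dots,-m$. Assume moreover that $\gamma_m\le Me^{-cm}$ for all $m$, with some constants $M,c>0$, and that $\gamma_0>0$. Let $(q(n))_{n\in\mathbb N}$ be a sequence of positive real numbers and let $(k(n))_{n\in\mathbb N}$ be a sequence of positive integers with $k(n)\to\infty$ and $\limsup_{n\to\infty}\frac{k(n)}{\log n}<\frac1{2\log|A|}$. Then $\sum_{i=0}^\infty(h_i-h)$ converges, and $Y_n:=q(n)\left(\frac1{k(n)}\hat H_{k(n),n}-h\right)$ satisfies: 1. If $q(n)/k(n)\to 0$, then $Y_n\to 0$ in probability. 2. If $q(n)/k(n)\to\alpha$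 with $0<\alpha<\infty$, then $Y_n\to\alpha\sum_{i=0}^\infty(h_i-h)$ in probability. 3. If $q(n)/k(n)\to+\infty$, then $\lim_{n\to\infty}\mathbf P\{Y_n<r\}=0$ for every $r\in\mathbb R$. Consequently, whatever the sequence $q$, $Y_n$ does not converge in distribution to a Gaussian law of positive variance. -/

import Mathlib

open MeasureTheory ProbabilityTheory Filter Topology

namespace ChainEntropy

noncomputable section

variable {A : Type*}

/-- The cylinder set of all sequences `x` that read the word `a` from position `m` on,
that is `x (m + j) = a j` for `0 ≤ j < k`. -/
def cylinder (m : ℤ) {k : ℕ} (a : Fin k → A) : Set (ℤ → A) :=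
  {x | ∀ j : Fin k, x (m + (j : ℕ)) = a j}

/-- `H(μ) = - ∑ μ(a) log μ(a)` for a probability vector `μ` on the words of length `k`
(with `0 log 0 = 0`). -/
def blockEntropy [Fintype A] {k : ℕ} (μ : (Fin k → A) → ℝ) : ℝ :=
  -∑ a : Fin k → A, μ a * Real.log (μ a)

/-- The empirical `k`-distribution of the sample `x_1, …, x_n`, where `k ≤ n`:
`(n - k + 1)⁻¹ ∑_{i = 1}^{n - k + 1} 1(x_i^{i + k - 1} = a)`.
(For `k > n` the sum is empty and the value is `0`.) -/
def empirical (x : ℤ → A) (n k : ℕ) (a : Fin k → A) : ℝ :=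
  (∑ i ∈ Finset.Icc 1 (n + 1 - k), (cylinder (i : ℤ) a).indicator (fun _ => (1 : ℝ)) x) /
    ((n + 1 - k : ℕ) : ℝ)

/-- The extensive empirical entropy of order `k` of the sample `x_1, …, x_n`. -/
def empiricalEntropy [Fintype A] (x : ℤ → A) (n k : ℕ) : ℝ :=
  blockEntropy (empirical x n k)

section Law

variable [MeasurableSpace A] (ν : Measure (ℤ → A))

/-- The law `ν` on `A^ℤ` is invariant under all shifts. -/
def IsStationary : Prop :=
  ∀ d : ℤ, ν.map (fun (x : ℤ → A) (i : ℤ) => x (i + d)) = ν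

/-- The marginal `ν_k(a_1^k)`. -/
def marginal (k : ℕ) (a : Fin k → A) : ℝ := ν.real (cylinder 1 a)

/-- `ν_{k+1}(a_0 | a_{-k}^{-1})`, the probability of reading `a_0` at time `0` given
`a_{-k}, …, a_{-1}` at the times `-k, …, -1`. The entry `a_{i}` is `a (i + k)`.
For `k = 0` the conditioning is void and this is `ν_1(a_0)`. -/
def condProb (k : ℕ) (a : Fin (k + 1) → A) : ℝ :=
  ν.real (cylinder (-(k : ℤ)) a) / ν.real (cylinder (-(k : ℤ)) (fun j : Fin k => a j.castSucc))

/-- `H_k = H(ν_k)`. -/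
def entropyH [Fintype A] (k : ℕ) : ℝ := blockEntropy (marginal ν k)

/-- `h_k = h(ν_{k+1}) = - ∑ ν_{k+1}(a_{-k}^0) log ν_{k+1}(a_0 | a_{-k}^{-1})`. -/
def condEntropy [Fintype A] (k : ℕ) : ℝ :=
  -∑ a : Fin (k + 1) → A, marginal ν (k + 1) a * Real.log (condProb ν k a)

/-- The entropy `h = lim H_k / k` of the chain. -/
def entropyRate [Fintype A] : ℝ :=
  limUnder atTop (fun k : ℕ => entropyH ν k / (k : ℝ))

/-- A history `a_{-∞}^0` is given by `a : ℕ → A`, where `a i` stands for `a_{-i}`;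
this is its final piece `a_{-m}, …, a_0` in the order of time. -/
def recent (m : ℕ) (a : ℕ → A) : Fin (m + 1) → A := fun j => a (m - (j : ℕ))

/-- `ν(a_0 | a_{-∞}^{-1}) = lim_m ν_{m+1}(a_0 | a_{-m}^{-1})`. -/
def transition (a : ℕ → A) : ℝ :=
  limUnder atTop (fun m : ℕ => condProb ν m (recent m a))

/-- Condition A: all words have positive probability. -/
def ConditionA : Prop := ∀ (n : ℕ) (a : Fin n → A), 0 < marginal ν n a

/-- Condition B: the limit that defines `transition` exists for every history. -/
def ConditionB : Prop :=
  ∀ a : ℕ → A, ∃ l : ℝ, Tendsto (fun m : ℕ => condProb ν m (recent m a)) atTop (𝓝 l)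

/-- Condition C: `γ_m ↘ 0`, and `γ_m` is the (finite) supremum of
`|ν(a_0 | a_{-∞}^{-1}) / ν(b_0 | b_{-∞}^{-1}) - 1|` over all histories `a`, `b` that agree at
the times `0, -1, …, -m`. (A vanishing denominator is excluded: with `a = b` it would give
the value `1` for every `m`, so that `γ_m ≥ 1`.) -/
def ConditionC (γ : ℕ → ℝ) : Prop :=
  Antitone γ ∧ Tendsto γ atTop (𝓝 0) ∧
    ∀ m : ℕ, IsLUB {r : ℝ | ∃ a b : ℕ → A, (∀ i ≤ m, a i = b i) ∧
      r = |transition ν a / transition ν b - 1|} (γ m)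

end Law

/-- The sequence decays exponentially fast: `γ_m ≤ M e^{-c m}` with `M, c > 0`. -/
def ExponentialDecay (γ : ℕ → ℝ) : Prop :=
  ∃ M > 0, ∃ c > 0, ∀ m : ℕ, γ m ≤ M * Real.exp (-c * m)

end

end ChainEntropy

open ChainEntropy

/-! Put `Z_n = Ĥ_{k(n),n} - k(n) h` and `S = ∑ (h_i - h)`. Then `Y_n = (q(n)/k(n)) Z_n`, and
everything follows from `Z_n → S` in probability together with `S > 0`: the three regimes are
scalings of a sequence with a positive constant limit. For the Gaussian claim, along a subsequence
the scaling converges in `[0, ∞]`, so the limit law is a point mass or the mass escapes to `+∞`.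

Bias. By the chain rule `H_k - k h = ∑_{i<k} (h_i - h)`. The difference `h_k - h_{k+1}` is the mean
of the logarithm of `pastRatio`. It is nonnegative by Gibbs' inequality and exponentially small by
(C), so the series converges (`entropy_convergence`). If `S` were `0`, all `h_k` would coincide,
every `pastRatio` would be `1`, the process would be independent and `γ_0 = 0`
(`exists_condEntropy_ne`).

Fluctuation. Condition (C) passes from infinite histories to finite words (`wordProb_div_le`). A
contracting cone of the transfer operator then gives exponential mixing, uniformly in the length of
the words (`abs_real_inter_sub_le`). Hence a word of probability `p` has an empirical frequency of
variance `O(p k / n)`. The factor `√p` of its standard deviation absorbs `log p`, so each of the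
`|A|^k` words contributes `O(√(k/n) + k/n)` to the mean error of the entropy. The growth condition
on `k(n)` makes `|A|^{2k} k / n` tend to `0`. -/

namespace ChainEntropy

/-! ### Words read backwards and their probabilities -/

section


variable {A : Type*}

/-- The set of all sequences that, read backwards from time `t` on, begin with the list `l`. -/
def pastSet (t : ℤ) : List A → Set (ℤ → A)
  | [] => Set.univ
  | a :: l => {x | x t = a} ∩ pastSet (t - 1) l

/-- The word `a_0, …, a_{k-1}` as a list, the most recent symbol `a_{k-1}` first. -/
def word {k : ℕ} (a : Fin k → A) : List A := (List.ofFn a).reverse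

lemma pastSet_append (t : ℤ) (b w : List A) :
    pastSet t (b ++ w) = pastSet t b ∩ pastSet (t - b.length) w := by
  induction b generalizing t with
  | nil => simp [pastSet]
  | cons a l ih =>
    simp only [List.cons_append, pastSet, ih, Set.inter_assoc, List.length_cons]
    congr 3
    push_cast
    ring_nf

lemma pastSet_shift (d t : ℤ) (l : List A) :
    (fun (x : ℤ → A) (i : ℤ) => x (i + d)) ⁻¹' pastSet t l = pastSet (t + d) l := by
  induction l generalizing t with
  | nil => rfl
  | cons a l ih =>
    simp only [pastSet, Set.preimage_inter, ih, Set.preimage_ofPred_eq]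
    congr 2
    ring

lemma word_last {k : ℕ} (a : Fin (k + 1) → A) :
    word a = a (Fin.last k) :: word (fun j : Fin k => a j.castSucc) := by
  rw [word, List.ofFn_succ', List.concat_eq_append, List.reverse_append]
  rfl

lemma word_first {k : ℕ} (a : Fin (k + 1) → A) :
    word a = word (fun j : Fin k => a j.succ) ++ [a 0] := by
  simp [word, List.ofFn_succ]

@[simp] lemma length_word {k : ℕ} (a : Fin k → A) : (word a).length = k := by simp [word]

lemma exists_word_eq (l : List A) : ∃ a : Fin l.length → A, word a = l :=
  ⟨fun i => l.reverse.get (i.cast (by simp)), by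
    have : List.ofFn (fun i : Fin l.length => l.reverse.get (i.cast (by simp))) = l.reverse := by
      apply List.ext_get <;> simp
    rw [word, this, List.reverse_reverse]⟩

/-- The last symbol of a word of length `k` that starts at `m` sits at time `m + k - 1`. With lists
read backwards, a step into the future is a `cons` and one more symbol of the past is an append at
the end. -/
lemma cylinder_eq_pastSet (m : ℤ) {k : ℕ} (a : Fin k → A) :
    cylinder m a = pastSet (m + k - 1) (word a) := by
  induction k with
  | zero => simp [cylinder, word, pastSet]
  | succ k ih =>
    rw [word_last, pastSet]
    have h := ih (fun j : Fin k => a j.castSucc)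
    have e : m + ((k + 1 : ℕ) : ℤ) - 1 = m + k := by push_cast; ring
    rw [e, ← h]
    ext x
    simp only [cylinder, Set.mem_ofPred_eq, Set.mem_inter_iff, Fin.forall_fin_succ', Fin.val_castSucc,
      Fin.val_last]
    exact and_comm

lemma sum_word_last [Fintype A] {k : ℕ} (F : List A → ℝ) :
    ∑ a : Fin (k + 1) → A, F (word a) = ∑ a : Fin k → A, ∑ s, F (s :: word a) := by
  rw [← (Fin.snocEquiv fun _ => A).sum_comp, Fintype.sum_prod_type_right]
  refine Finset.sum_congr rfl fun a _ => Finset.sum_congr rfl fun s _ => ?_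
  rw [word_last]
  simp [Fin.snocEquiv]

lemma sum_word_first [Fintype A] {k : ℕ} (F : List A → ℝ) :
    ∑ a : Fin (k + 1) → A, F (word a) = ∑ a : Fin k → A, ∑ s, F (word a ++ [s]) := by
  rw [← (Fin.consEquiv fun _ => A).sum_comp, Fintype.sum_prod_type_right]
  refine Finset.sum_congr rfl fun a _ => Finset.sum_congr rfl fun s _ => ?_
  rw [word_first]
  simp [Fin.consEquiv]

lemma word_recent (m : ℕ) (a : ℕ → A) : word (recent m a) = (List.range (m + 1)).map a := by
  refine List.ext_getElem (by simp) fun n h1 h2 => ?_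
  have h3 : n < m + 1 := by simpa using h2
  simp only [word, recent, List.getElem_reverse, List.getElem_ofFn, List.length_ofFn,
    List.getElem_map, List.getElem_range]
  congr 1
  omega

section Law

variable [MeasurableSpace A]

/-- The probability of reading the list `l` backwards from time `0` on. -/
noncomputable def wordProb (ν : Measure (ℤ → A)) (l : List A) : ℝ := ν.real (pastSet 0 l)

lemma wordProb_nil {ν : Measure (ℤ → A)} [IsProbabilityMeasure ν] : wordProb ν [] = 1 := by
  simp [wordProb, pastSet]

variable [DiscreteMeasurableSpace A]

lemma measurableSet_pastSet (t : ℤ) (l : List A) : MeasurableSet (pastSet t l) := by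
  induction l generalizing t with
  | nil => exact MeasurableSet.univ
  | cons a l ih =>
    exact (measurable_pi_apply t (measurableSet_singleton a)).inter (ih _)

lemma IsStationary.real_pastSet {ν : Measure (ℤ → A)} (h : IsStationary ν) (t : ℤ) (l : List A) :
    ν.real (pastSet t l) = wordProb ν l := by
  have h1 := h t
  have hm : Measurable (fun (x : ℤ → A) (i : ℤ) => x (i + t)) := by fun_prop
  rw [wordProb]
  conv_rhs => rw [← h1]
  rw [map_measureReal_apply hm (measurableSet_pastSet _ _), pastSet_shift, zero_add]

lemma sum_real_inter [Fintype A] (ν : Measure (ℤ → A)) [IsProbabilityMeasure ν] (t : ℤ)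
    (E : Set (ℤ → A)) : ∑ s, ν.real ({x | x t = s} ∩ E) = ν.real E := by
  have h := sum_measureReal_preimage_singleton (μ := ν.restrict E) Finset.univ
    (f := fun x : ℤ → A => x t) (fun y _ => measurable_pi_apply t (measurableSet_singleton y))
  have h2 : ∀ s, (ν.restrict E).real ((fun x : ℤ → A => x t) ⁻¹' {s})
      = ν.real ({x | x t = s} ∩ E) := fun s =>
    measureReal_restrict_apply (measurable_pi_apply t (measurableSet_singleton s))
  simp only [h2] at h
  simpa using h

variable {ν : Measure (ℤ → A)}

lemma marginal_eq_wordProb (h : IsStationary ν) {k : ℕ} (a : Fin k → A) :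
    marginal ν k a = wordProb ν (word a) := by
  rw [marginal, cylinder_eq_pastSet, h.real_pastSet]

lemma condProb_eq_wordProb (h : IsStationary ν) {k : ℕ} (a : Fin (k + 1) → A) :
    condProb ν k a
      = wordProb ν (word a) / wordProb ν (word (fun j : Fin k => a j.castSucc)) := by
  rw [condProb, cylinder_eq_pastSet, cylinder_eq_pastSet, h.real_pastSet, h.real_pastSet]

lemma wordProb_pos (h : IsStationary ν) (hA : ConditionA ν) (l : List A) : 0 < wordProb ν l := by
  obtain ⟨a, ha⟩ := exists_word_eq l
  rw [← ha, ← marginal_eq_wordProb h]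
  exact hA _ _

lemma sum_wordProb_cons [Fintype A] [IsProbabilityMeasure ν] (h : IsStationary ν) (l : List A) :
    ∑ s, wordProb ν (s :: l) = wordProb ν l := by
  simp only [wordProb, pastSet]
  rw [sum_real_inter, h.real_pastSet, wordProb]

lemma sum_wordProb_append [Fintype A] [IsProbabilityMeasure ν] (l : List A) :
    ∑ s, wordProb ν (l ++ [s]) = wordProb ν l := by
  simp only [wordProb, pastSet_append, pastSet, Set.inter_univ]
  simp_rw [Set.inter_comm (pastSet 0 l)]
  rw [sum_real_inter]

end Law

end

/-! ### From infinite histories to finite words -/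

section


variable {A : Type*}

/-- Dependent choice: the word is extended into the past one symbol at a time without losing `Q`,
and the nested words define a history. -/
lemma exists_history_of_step (Q : List A → Prop)
    (step : ∀ l, l ≠ [] → Q l → ∃ s, Q (l ++ [s])) {l : List A} (hl : l ≠ []) (hQ : Q l) :
    ∃ x : ℕ → A, (List.range l.length).map x = l ∧
      ∀ n, l.length ≤ n → Q ((List.range n).map x) := by
  have hstep : ∀ l' : {l' : List A // l' ≠ [] ∧ Q l'}, ∃ s, Q (l'.1 ++ [s]) :=
    fun l' => step _ l'.2.1 l'.2.2
  choose f hf using hstep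
  let L : ℕ → {l' : List A // l' ≠ [] ∧ Q l'} := fun n =>
    Nat.rec ⟨l, hl, hQ⟩ (fun _ l' => ⟨l'.1 ++ [f l'], by simp, hf l'⟩) n
  have hL : ∀ n, (L (n + 1)).1 = (L n).1 ++ [f (L n)] := fun n => rfl
  have hlen : ∀ n, (L n).1.length = l.length + n := by
    intro n
    induction n with
    | zero => rfl
    | succ n ih => rw [hL, List.length_append, ih]; rfl
  have hpre : ∀ a b, a ≤ b → (L a).1 <+: (L b).1 := by
    intro a b hab
    induction b, hab using Nat.le_induction with
    | base => exact List.prefix_rfl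
    | succ n _ ih => exact ih.trans (by rw [hL]; exact List.prefix_append _ _)
  have hl0 : 0 < l.length := List.length_pos_iff.mpr hl
  have hget : ∀ i, i < (L i).1.length := fun i => by rw [hlen]; omega
  have key : ∀ n, (List.range (l.length + n)).map (fun i => (L i).1[i]'(hget i)) = (L n).1 := by
    intro n
    refine List.ext_getElem (by simp [hlen]) fun i h1 h2 => ?_
    simp only [List.getElem_map, List.getElem_range]
    rcases le_total i n with h | h
    · exact (hpre i n h).getElem _
    · exact ((hpre n i h).getElem _).symm
  refine ⟨fun i => (L i).1[i]'(hget i), key 0, fun n hn => ?_⟩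
  obtain ⟨j, rfl⟩ := Nat.exists_eq_add_of_le hn
  rw [key]
  exact (L j).2.2

/-- The axioms of the probabilities of finite words of a stationary process with full support,
the words being written with the most recent symbol first. -/
structure IsWordLaw [Fintype A] (p : List A → ℝ) : Prop where
  pos : ∀ l, 0 < p l
  nil : p [] = 1
  cons : ∀ l, ∑ s, p (s :: l) = p l
  append : ∀ l, ∑ s, p (l ++ [s]) = p l

/-- The left side is the average of the right sides with the weights `p (l ++ [s]) / p l`, so some
term is at least the average. -/
lemma IsWordLaw.exists_le_div [Fintype A] {p : List A → ℝ} (hp : IsWordLaw p) (a : A)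
    (l : List A) : ∃ s, p (a :: l) / p l ≤ p (a :: l ++ [s]) / p (l ++ [s]) := by
  by_contra! h
  have h1 : ∑ s, p (a :: l ++ [s]) < ∑ s, p (a :: l) / p l * p (l ++ [s]) := by
    refine Finset.sum_lt_sum_of_nonempty ⟨a, Finset.mem_univ a⟩ fun s _ => ?_
    exact (div_lt_iff₀ (hp.pos _)).1 (h s)
  rw [← Finset.mul_sum, hp.append, hp.append, div_mul_cancel₀ _ (hp.pos _).ne'] at h1
  exact lt_irrefl _ h1

lemma IsWordLaw.exists_div_le [Fintype A] {p : List A → ℝ} (hp : IsWordLaw p) (a : A)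
    (l : List A) : ∃ s, p (a :: l ++ [s]) / p (l ++ [s]) ≤ p (a :: l) / p l := by
  by_contra! h
  have h1 : ∑ s, p (a :: l) / p l * p (l ++ [s]) < ∑ s, p (a :: l ++ [s]) := by
    refine Finset.sum_lt_sum_of_nonempty ⟨a, Finset.mem_univ a⟩ fun s _ => ?_
    exact (lt_div_iff₀ (hp.pos _)).1 (h s)
  rw [← Finset.mul_sum, hp.append, hp.append, div_mul_cancel₀ _ (hp.pos _).ne'] at h1
  exact lt_irrefl _ h1

variable [MeasurableSpace A] {ν : Measure (ℤ → A)}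

lemma ConditionC.nonneg [Nonempty A] {γ : ℕ → ℝ} (hC : ConditionC ν γ) (m : ℕ) : 0 ≤ γ m := by
  obtain ⟨a⟩ := ‹Nonempty A›
  exact (abs_nonneg _).trans ((hC.2.2 m).1 ⟨fun _ => a, fun _ => a, fun _ _ => rfl, rfl⟩)

variable [DiscreteMeasurableSpace A]

lemma isWordLaw_wordProb [Fintype A] [IsProbabilityMeasure ν] (h : IsStationary ν)
    (hA : ConditionA ν) : IsWordLaw (wordProb ν) :=
  ⟨wordProb_pos h hA, wordProb_nil, sum_wordProb_cons h, sum_wordProb_append⟩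

lemma condProb_recent (h : IsStationary ν) (m : ℕ) (x : ℕ → A) :
    condProb ν m (recent m x) = wordProb ν ((List.range (m + 1)).map x) /
      wordProb ν ((List.range (m + 1)).map x).tail := by
  rw [condProb_eq_wordProb h, word_recent]
  congr 2
  have h1 := word_last (recent m x)
  rw [word_recent] at h1
  rw [h1]
  rfl

lemma tendsto_transition (h : IsStationary ν) (hB : ConditionB ν) (x : ℕ → A) :
    Tendsto (fun m : ℕ => wordProb ν ((List.range (m + 1)).map x) /
      wordProb ν ((List.range (m + 1)).map x).tail) atTop (𝓝 (transition ν x)) := by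
  have h1 : Tendsto (fun m : ℕ => condProb ν m (recent m x)) atTop (𝓝 (transition ν x)) :=
    tendsto_nhds_limUnder (hB x)
  simpa only [condProb_recent h] using h1

/-- Extending the past by `exists_le_div` keeps the conditional probability at or above its initial
value, and so does the limit supplied by (B). -/
lemma exists_history_le_transition [Fintype A] (hp : IsWordLaw (wordProb ν))
    (h : IsStationary ν) (hB : ConditionB ν) (a : A) (l : List A) :
    ∃ x : ℕ → A, (List.range (l.length + 1)).map x = a :: l ∧
      wordProb ν (a :: l) / wordProb ν l ≤ transition ν x := by
  obtain ⟨x, hx, hQ⟩ := exists_history_of_step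
    (fun l' => wordProb ν (a :: l) / wordProb ν l ≤ wordProb ν l' / wordProb ν l'.tail)
    (fun l' hl' hq => by
      obtain ⟨b, t, rfl⟩ := List.exists_cons_of_ne_nil hl'
      obtain ⟨s, hs⟩ := hp.exists_le_div b t
      exact ⟨s, hq.trans hs⟩)
    (List.cons_ne_nil a l) le_rfl
  refine ⟨x, hx, ge_of_tendsto (tendsto_transition h hB x) ?_⟩
  filter_upwards [eventually_ge_atTop l.length] with n hn
  exact hQ (n + 1) (by simpa using hn)

lemma exists_history_transition_le [Fintype A] (hp : IsWordLaw (wordProb ν))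
    (h : IsStationary ν) (hB : ConditionB ν) (a : A) (l : List A) :
    ∃ x : ℕ → A, (List.range (l.length + 1)).map x = a :: l ∧
      transition ν x ≤ wordProb ν (a :: l) / wordProb ν l := by
  obtain ⟨x, hx, hQ⟩ := exists_history_of_step
    (fun l' => wordProb ν l' / wordProb ν l'.tail ≤ wordProb ν (a :: l) / wordProb ν l)
    (fun l' hl' hq => by
      obtain ⟨b, t, rfl⟩ := List.exists_cons_of_ne_nil hl'
      obtain ⟨s, hs⟩ := hp.exists_div_le b t
      exact ⟨s, le_trans hs hq⟩)
    (List.cons_ne_nil a l) le_rfl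
  refine ⟨x, hx, le_of_tendsto (tendsto_transition h hB x) ?_⟩
  filter_upwards [eventually_ge_atTop l.length] with n hn
  exact hQ (n + 1) (by simpa using hn)

/-- At a zero the convention `0 / 0 = 0` gives the value `|0 - 1| = 1` for the pair `(x, x)`, whence
`1 ≤ γ m` for all `m`, against `γ → 0`. -/
lemma transition_pos [Fintype A] (hp : IsWordLaw (wordProb ν)) (h : IsStationary ν)
    (hB : ConditionB ν) {γ : ℕ → ℝ} (hC : ConditionC ν γ) (x : ℕ → A) : 0 < transition ν x := by
  have h0 : 0 ≤ transition ν x := ge_of_tendsto' (tendsto_transition h hB x) fun n =>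
    div_nonneg (hp.pos _).le (hp.pos _).le
  refine h0.lt_of_ne' fun h1 => ?_
  have h2 : ∀ m, 1 ≤ γ m := fun m => (hC.2.2 m).1 ⟨x, x, fun _ _ => rfl, by simp [h1]⟩
  have h3 := ge_of_tendsto' hC.2.1 h2
  norm_num at h3

/-- The transition probabilities given two pasts that agree in their last `|u|` symbols. -/
lemma wordProb_div_le [Fintype A] (hp : IsWordLaw (wordProb ν)) (h : IsStationary ν)
    (hB : ConditionB ν) {γ : ℕ → ℝ} (hC : ConditionC ν γ) (a : A) (u v w : List A) :
    wordProb ν (a :: (u ++ v)) / wordProb ν (u ++ v)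
      ≤ (1 + γ u.length) * (wordProb ν (a :: (u ++ w)) / wordProb ν (u ++ w)) := by
  obtain ⟨x, hx, hx'⟩ := exists_history_le_transition hp h hB a (u ++ v)
  obtain ⟨y, hy, hy'⟩ := exists_history_transition_le hp h hB a (u ++ w)
  -- Both histories begin with `a :: u`, which has `u.length + 1` symbols; this matches the index
  -- range `0, …, m` of (C) with `m = u.length`.
  have hagree : ∀ i ≤ u.length, x i = y i := by
    intro i hi
    have h1 : ∀ (z : ℕ → A) (r : List A), (List.range ((u ++ r).length + 1)).map z
        = a :: (u ++ r) → z i = (a :: u)[i]'(by simp; omega) := by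
      intro z r hz
      have h2 := congrArg (fun l => l[i]?) hz
      simp only [List.getElem?_map] at h2
      rw [List.getElem?_range (by simp; omega), ← List.cons_append,
        List.getElem?_append_left (by simp; omega), List.getElem?_eq_getElem (by simp; omega)] at h2
      simpa using h2
    rw [h1 x v hx, h1 y w hy]
  have hγ : |transition ν x / transition ν y - 1| ≤ γ u.length :=
    (hC.2.2 _).1 ⟨x, y, hagree, rfl⟩
  have hy0 := transition_pos hp h hB hC y
  have h1 : transition ν x ≤ (1 + γ u.length) * transition ν y := by
    rw [← div_le_iff₀ hy0]
    linarith [le_abs_self (transition ν x / transition ν y - 1)]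
  have h0 : 0 ≤ γ u.length := (abs_nonneg _).trans hγ
  exact hx'.trans (h1.trans (by gcongr))

end

/-! ### Cone contraction for the transfer operator, and exponential mixing -/

section


variable {A : Type*}

/-- Nonnegative functions of a finite past that depend on the remote past with a multiplicative
error of at most `exp (K * θ ^ m)`, if the last `m` symbols are known. -/
structure InCone (K θ : ℝ) (f : List A → ℝ) : Prop where
  nonneg : ∀ w, 0 ≤ f w
  ratio : ∀ u v w, f (u ++ v) ≤ Real.exp (K * θ ^ u.length) * f (u ++ w)

section Transfer

variable [Fintype A] {p : List A → ℝ}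

/-- The expectation of `f` one step later, given the past. -/
noncomputable def transfer (p : List A → ℝ) (f : List A → ℝ) (w : List A) : ℝ :=
  ∑ s, p (s :: w) / p w * f (s :: w)

lemma IsWordLaw.sum_div (hp : IsWordLaw p) (w : List A) : ∑ s, p (s :: w) / p w = 1 := by
  rw [← Finset.sum_div, hp.cons, div_self (hp.pos w).ne']

lemma IsWordLaw.transfer_sub_const (hp : IsWordLaw p) (f : List A → ℝ) (c : ℝ) (w : List A) :
    transfer p (fun l => f l - c) w = transfer p f w - c := by
  simp only [transfer, mul_sub, Finset.sum_sub_distrib, ← Finset.sum_mul, hp.sum_div, one_mul]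

lemma IsWordLaw.transfer_le (hp : IsWordLaw p) {f : List A → ℝ} {S : ℝ} (hf : ∀ l, f l ≤ S)
    (w : List A) : transfer p f w ≤ S := by
  calc transfer p f w ≤ ∑ s, p (s :: w) / p w * S :=
        Finset.sum_le_sum fun s _ =>
          mul_le_mul_of_nonneg_left (hf _) (div_nonneg (hp.pos _).le (hp.pos _).le)
    _ = S := by rw [← Finset.sum_mul, hp.sum_div, one_mul]

lemma IsWordLaw.le_transfer (hp : IsWordLaw p) {f : List A → ℝ} {S : ℝ} (hf : ∀ l, S ≤ f l)
    (w : List A) : S ≤ transfer p f w := by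
  calc S = ∑ s, p (s :: w) / p w * S := by rw [← Finset.sum_mul, hp.sum_div, one_mul]
    _ ≤ transfer p f w := Finset.sum_le_sum fun s _ =>
          mul_le_mul_of_nonneg_left (hf _) (div_nonneg (hp.pos _).le (hp.pos _).le)

/-- The transition probabilities depend on the remote past with an exponentially small
multiplicative error. -/
def HasExpRatio (p : List A → ℝ) (K θ : ℝ) : Prop :=
  ∀ (a : A) (u v w : List A), p (a :: (u ++ v)) / p (u ++ v) ≤
    Real.exp (K * (1 - θ) / 2 * θ ^ u.length) * (p (a :: (u ++ w)) / p (u ++ w))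

variable {K θ : ℝ}

/-- The new symbol lengthens the common past by one, so the exponents add up to `K (1 - θ)/2 + K θ =
K (1 + θ)/2`, times `θ ^ u.length`. The image lies in a narrower cone. -/
lemma InCone.transfer_ratio (hp : IsWordLaw p) (hr : HasExpRatio p K θ) {f : List A → ℝ}
    (hf : InCone K θ f) (u v w : List A) : transfer p f (u ++ v) ≤
      Real.exp ((1 + θ) / 2 * (K * θ ^ u.length)) * transfer p f (u ++ w) := by
  rw [transfer, transfer, Finset.mul_sum]
  refine Finset.sum_le_sum fun s _ => ?_
  have h1 := hr s u v w
  have h2 := hf.ratio (s :: u) v w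
  rw [List.cons_append, List.cons_append, List.length_cons] at h2
  have e : Real.exp ((1 + θ) / 2 * (K * θ ^ u.length)) =
      Real.exp (K * (1 - θ) / 2 * θ ^ u.length) * Real.exp (K * θ ^ (u.length + 1)) := by
    rw [← Real.exp_add]; congr 1; ring
  calc _ ≤ (Real.exp (K * (1 - θ) / 2 * θ ^ u.length) * (p (s :: (u ++ w)) / p (u ++ w))) *
        (Real.exp (K * θ ^ (u.length + 1)) * f (s :: (u ++ w))) :=
        mul_le_mul h1 h2 (hf.nonneg _) (mul_nonneg (Real.exp_nonneg _)
          (div_nonneg (hp.pos _).le (hp.pos _).le))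
    _ = _ := by rw [e]; ring

/-- Rearranged, this says `e^{τB} y - c ≤ e^B (y - c)`: the room between the two cones pays for the
subtraction of a small constant. It follows from `e^B - 1 ≤ B e^K` and `(1 - τ) B ≤ e^B - e^{τB}`.
-/
lemma mul_exp_sub_one_le {B K τ c y : ℝ} (hB : 0 ≤ B) (hBK : B ≤ K) (hτ0 : 0 ≤ τ) (hτ1 : τ ≤ 1)
    (hy : 0 ≤ y) (hc : c ≤ (1 - τ) * Real.exp (-K) * y) :
    c * (Real.exp B - 1) ≤ (Real.exp B - Real.exp (τ * B)) * y := by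
  have h1 : Real.exp B - 1 ≤ B * Real.exp K := by
    have h := Real.add_one_le_exp (-B)
    have h3 : Real.exp B * Real.exp (-B) = 1 := by rw [← Real.exp_add]; simp
    have h4 : Real.exp B ≤ Real.exp K := Real.exp_le_exp.2 hBK
    nlinarith [Real.exp_pos B, mul_le_mul_of_nonneg_left h4 hB]
  have h2 : (1 - τ) * B ≤ Real.exp B - Real.exp (τ * B) := by
    have e : Real.exp B = Real.exp (τ * B) * Real.exp ((1 - τ) * B) := by
      rw [← Real.exp_add]; congr 1; ring
    have h3 := Real.add_one_le_exp ((1 - τ) * B)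
    have h4 : 1 ≤ Real.exp (τ * B) := Real.one_le_exp (mul_nonneg hτ0 hB)
    have h5 : 0 ≤ (1 - τ) * B := mul_nonneg (by linarith) hB
    nlinarith
  have h3 : 0 ≤ Real.exp B - 1 := by linarith [Real.one_le_exp hB]
  have hK : Real.exp (-K) * Real.exp K = 1 := by rw [← Real.exp_add]; simp
  have h0 : 0 ≤ (1 - τ) * Real.exp (-K) * y :=
    mul_nonneg (mul_nonneg (by linarith) (Real.exp_nonneg _)) hy
  calc c * (Real.exp B - 1) ≤ ((1 - τ) * Real.exp (-K) * y) * (B * Real.exp K) :=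
        mul_le_mul hc h1 h3 h0
    _ = ((1 - τ) * B) * y * (Real.exp (-K) * Real.exp K) := by ring
    _ = ((1 - τ) * B) * y := by rw [hK, mul_one]
    _ ≤ _ := mul_le_mul_of_nonneg_right h2 hy

/-- The contraction rate of the transfer operator on the cone. -/
noncomputable def contractionRate (K θ : ℝ) : ℝ := 1 - (1 - θ) / 2 * Real.exp (-(3 * K))

lemma contractionRate_nonneg (hK : 0 ≤ K) (hθ0 : 0 ≤ θ) : 0 ≤ contractionRate K θ := by
  have h := Real.exp_le_one_iff.2 (by linarith : -(3 * K) ≤ 0)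
  have h2 := Real.exp_pos (-(3 * K))
  rw [contractionRate]
  nlinarith

lemma contractionRate_lt_one (hθ1 : θ < 1) : contractionRate K θ < 1 := by
  have h2 := Real.exp_pos (-(3 * K))
  rw [contractionRate]
  nlinarith

/-- A Doeblin-type step: a constant comparable to the whole function can be removed from its image
without leaving the cone, and this lowers the upper bound by a fixed factor. -/
lemma InCone.exists_transfer_sub (hp : IsWordLaw p) (hr : HasExpRatio p K θ) (hK : 0 ≤ K)
    (hθ0 : 0 ≤ θ) (hθ1 : θ < 1) {f : List A → ℝ} (hf : InCone K θ f) {S : ℝ} (hS : ∀ w, f w ≤ S) :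
    ∃ c, InCone K θ (fun w => transfer p f w - c) ∧
      ∀ w, transfer p f w - c ≤ contractionRate K θ * S := by
  have hle : ∀ w, f w ≤ Real.exp K * f [] := fun w => by simpa using hf.ratio [] w []
  have hge : ∀ w, Real.exp (-K) * f [] ≤ f w := fun w => by
    have h : f [] ≤ Real.exp K * f w := by simpa using hf.ratio [] [] w
    calc Real.exp (-K) * f [] ≤ Real.exp (-K) * (Real.exp K * f w) := by gcongr
      _ = f w := by rw [← mul_assoc, ← Real.exp_add]; simp
  have hTle := hp.transfer_le hle
  have hTge := hp.le_transfer hge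
  have hT0 : ∀ w, 0 ≤ transfer p f w := hp.le_transfer hf.nonneg
  -- Small enough for `mul_exp_sub_one_le`, since the image is at least `e^{-K} f []`. As the image
  -- is also at most `e^K f []`, `c` is at least `(1 - θ)/2 · e^{-3K}` times it, which explains
  -- `contractionRate`.
  set c : ℝ := (1 - (1 + θ) / 2) * Real.exp (-(2 * K)) * f [] with hc
  have e2 : Real.exp (-(2 * K)) = Real.exp (-K) * Real.exp (-K) := by
    rw [← Real.exp_add]; ring_nf
  have e3 : Real.exp (-(3 * K)) = Real.exp (-(2 * K)) * Real.exp (-K) := by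
    rw [← Real.exp_add]; ring_nf
  have hτ : 0 ≤ 1 - (1 + θ) / 2 := by linarith
  have hcT : ∀ w, c ≤ (1 - (1 + θ) / 2) * Real.exp (-K) * transfer p f w := fun w => by
    rw [hc, e2]
    calc _ = (1 - (1 + θ) / 2) * Real.exp (-K) * (Real.exp (-K) * f []) := by ring
      _ ≤ _ := mul_le_mul_of_nonneg_left (hTge w) (mul_nonneg hτ (Real.exp_nonneg _))
  refine ⟨c, ⟨fun w => ?_, fun u v w => ?_⟩, fun w => ?_⟩
  · have h1 : (1 - (1 + θ) / 2) * Real.exp (-K) ≤ 1 :=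
      mul_le_one₀ (by linarith) (Real.exp_nonneg _) (Real.exp_le_one_iff.2 (by linarith))
    have h2 := mul_le_mul_of_nonneg_right h1 (hT0 w)
    have h3 := hcT w
    show 0 ≤ transfer p f w - c
    linarith
  · have hpow : θ ^ u.length ≤ 1 := pow_le_one₀ hθ0 hθ1.le
    have hB0 : 0 ≤ K * θ ^ u.length := by positivity
    have h1 := mul_exp_sub_one_le hB0 (by nlinarith) (by linarith : (0 : ℝ) ≤ (1 + θ) / 2)
      (by linarith) (hT0 (u ++ w)) (hcT (u ++ w))
    have h2 := hf.transfer_ratio hp hr u v w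
    show transfer p f (u ++ v) - c ≤ _ * (transfer p f (u ++ w) - c)
    linarith
  · have h1 : Real.exp (-K) * transfer p f w ≤ f [] := by
      calc _ ≤ Real.exp (-K) * (Real.exp K * f []) :=
            mul_le_mul_of_nonneg_left (hTle w) (Real.exp_nonneg _)
        _ = f [] := by rw [← mul_assoc, ← Real.exp_add]; simp
    have h2 : (1 - θ) / 2 * Real.exp (-(3 * K)) * transfer p f w ≤ c := by
      rw [hc, e3]
      calc _ = (1 - (1 + θ) / 2) * Real.exp (-(2 * K)) * (Real.exp (-K) * transfer p f w) := by ring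
        _ ≤ _ := mul_le_mul_of_nonneg_left h1 (mul_nonneg hτ (Real.exp_nonneg _))
    have h3 := mul_le_mul_of_nonneg_left (hp.transfer_le hS w) (contractionRate_nonneg hK hθ0)
    rw [contractionRate] at h3 ⊢
    linarith

/-- The transfer operator fixes constants, so the removed constants accumulate into a single `c`.
What remains lies between `0` and `contractionRate K θ ^ g * S`, which bounds the oscillation. -/
lemma InCone.abs_iterate_transfer_sub_le (hp : IsWordLaw p) (hr : HasExpRatio p K θ) (hK : 0 ≤ K)
    (hθ0 : 0 ≤ θ) (hθ1 : θ < 1) {f : List A → ℝ} (hf : InCone K θ f) {S : ℝ} (hS : ∀ w, f w ≤ S)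
    (g : ℕ) (w : List A) :
    |(transfer p)^[g] f w - (transfer p)^[g] f []| ≤ contractionRate K θ ^ g * S := by
  have key : ∃ c, InCone K θ (fun w => (transfer p)^[g] f w - c) ∧
      ∀ w, (transfer p)^[g] f w - c ≤ contractionRate K θ ^ g * S := by
    induction g with
    | zero => exact ⟨0, by simpa using hf, by simpa using hS⟩
    | succ g ih =>
      obtain ⟨c, hc, hcS⟩ := ih
      obtain ⟨d, hd, hdS⟩ := hc.exists_transfer_sub hp hr hK hθ0 hθ1 hcS
      have e : ∀ w, transfer p (fun w => (transfer p)^[g] f w - c) w - d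
          = (transfer p)^[g + 1] f w - (c + d) := fun w => by
        rw [hp.transfer_sub_const, Function.iterate_succ_apply']; ring
      simp only [e] at hd hdS
      exact ⟨c + d, hd, fun w => (hdS w).trans_eq (by ring)⟩
  obtain ⟨c, hc, hcS⟩ := key
  have h1 := hc.nonneg w
  have h2 := hc.nonneg []
  have h3 := hcS w
  have h4 := hcS []
  rw [abs_le]
  constructor <;> linarith

/-- The probability of `b` given `w` is a product of transition probabilities whose errors form a
geometric series. The cone does not depend on `b`, so the mixing rate is the same for all word
lengths. -/
lemma inCone_wordProb_append (hp : IsWordLaw p) (hr : HasExpRatio p K θ) (hK : 0 ≤ K)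
    (hθ0 : 0 ≤ θ) (hθ1 : θ < 1) (b : List A) : InCone K θ (fun w => p (b ++ w) / p w) := by
  refine ⟨fun w => div_nonneg (hp.pos _).le (hp.pos _).le, fun u v w => ?_⟩
  have key : p (b ++ (u ++ v)) / p (u ++ v) ≤
      Real.exp (K * (1 - θ ^ b.length) * θ ^ u.length) * (p (b ++ (u ++ w)) / p (u ++ w)) := by
    induction b with
    | nil => simp [div_self (hp.pos _).ne']
    | cons a b ih =>
      have h1 := hr a (b ++ u) v w
      simp only [List.append_assoc, List.length_append] at h1
      have hq : ∀ r, p (a :: b ++ (u ++ r)) / p (u ++ r) = p (a :: (b ++ (u ++ r))) /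
          p (b ++ (u ++ r)) * (p (b ++ (u ++ r)) / p (u ++ r)) := fun r => by
        rw [div_mul_div_cancel₀ (hp.pos _).ne']; rfl
      rw [hq, hq]
      have h0 : 0 ≤ p (b ++ (u ++ v)) / p (u ++ v) := div_nonneg (hp.pos _).le (hp.pos _).le
      have h0' : ∀ r, 0 ≤ p (b ++ (u ++ r)) / p (u ++ r) :=
        fun r => div_nonneg (hp.pos _).le (hp.pos _).le
      have h0'' : 0 ≤ p (a :: (b ++ (u ++ w))) / p (b ++ (u ++ w)) :=
        div_nonneg (hp.pos _).le (hp.pos _).le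
      have hexp : Real.exp (K * (1 - θ) / 2 * θ ^ (b.length + u.length)) *
          Real.exp (K * (1 - θ ^ b.length) * θ ^ u.length) ≤
          Real.exp (K * (1 - θ ^ (a :: b).length) * θ ^ u.length) := by
        rw [← Real.exp_add, Real.exp_le_exp, List.length_cons, pow_succ, pow_add]
        have : 0 ≤ K * (1 - θ) / 2 * (θ ^ b.length * θ ^ u.length) :=
          mul_nonneg (div_nonneg (mul_nonneg hK (by linarith)) (by norm_num)) (by positivity)
        linarith
      calc _ ≤ (Real.exp (K * (1 - θ) / 2 * θ ^ (b.length + u.length)) *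
            (p (a :: (b ++ (u ++ w))) / p (b ++ (u ++ w)))) *
            (Real.exp (K * (1 - θ ^ b.length) * θ ^ u.length) *
              (p (b ++ (u ++ w)) / p (u ++ w))) :=
            mul_le_mul h1 ih h0 (mul_nonneg (Real.exp_nonneg _) h0'')
        _ = (Real.exp (K * (1 - θ) / 2 * θ ^ (b.length + u.length)) *
            Real.exp (K * (1 - θ ^ b.length) * θ ^ u.length)) * (p (a :: (b ++ (u ++ w))) /
              p (b ++ (u ++ w)) * (p (b ++ (u ++ w)) / p (u ++ w))) := by ring
        _ ≤ _ := mul_le_mul_of_nonneg_right hexp (mul_nonneg h0'' (h0' w))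
  refine key.trans (mul_le_mul_of_nonneg_right (Real.exp_le_exp.2 ?_)
    (div_nonneg (hp.pos _).le (hp.pos _).le))
  have : 0 ≤ K * θ ^ b.length * θ ^ u.length := by positivity
  linarith

lemma IsWordLaw.cons_le (hp : IsWordLaw p) (s : A) (l : List A) : p (s :: l) ≤ p l := by
  rw [← hp.cons l]
  exact Finset.single_le_sum (f := fun s => p (s :: l)) (fun s _ => (hp.pos _).le)
    (Finset.mem_univ s)

lemma IsWordLaw.append_le (hp : IsWordLaw p) (b l : List A) : p (b ++ l) ≤ p l := by
  induction b with
  | nil => exact le_rfl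
  | cons s b ih => exact (hp.cons_le s _).trans ih

lemma IsWordLaw.le_one (hp : IsWordLaw p) (l : List A) : p l ≤ 1 := by
  simpa [hp.nil] using hp.append_le l []

end Transfer

variable [Fintype A] [MeasurableSpace A] [DiscreteMeasurableSpace A] {ν : Measure (ℤ → A)}

/-- Each application of `transfer` sums out one symbol of the gap; the induction removes the one
next to `w`. -/
lemma real_pastSet_inter_pastSet [IsProbabilityMeasure ν] (hp : IsWordLaw (wordProb ν))
    (h : IsStationary ν) (t : ℤ) (b w : List A) (g : ℕ) :
    ν.real (pastSet t b ∩ pastSet (t - b.length - g) w) = wordProb ν w *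
      (transfer (wordProb ν))^[g] (fun w => wordProb ν (b ++ w) / wordProb ν w) w := by
  induction g generalizing w with
  | zero =>
    rw [Nat.cast_zero, sub_zero, ← pastSet_append, h.real_pastSet, Function.iterate_zero, id,
      mul_div_cancel₀ _ (hp.pos w).ne']
  | succ g ih =>
    rw [Function.iterate_succ_apply', transfer, Finset.mul_sum,
      ← sum_real_inter ν (t - b.length - g)]
    refine Finset.sum_congr rfl fun s _ => ?_
    rw [← mul_assoc, mul_div_cancel₀ _ (hp.pos w).ne', ← ih, pastSet]
    have e : t - b.length - ((g + 1 : ℕ) : ℤ) = t - b.length - g - 1 := by push_cast; ring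
    rw [e, Set.inter_left_comm]

/-- Exponentially fast mixing: a word that follows a word `w` after a gap of length `g` is almost
independent of `w`. -/
lemma abs_real_inter_sub_le [IsProbabilityMeasure ν] (hp : IsWordLaw (wordProb ν))
    (h : IsStationary ν) {K θ : ℝ} (hr : HasExpRatio (wordProb ν) K θ) (hK : 0 ≤ K)
    (hθ0 : 0 ≤ θ) (hθ1 : θ < 1) (t : ℤ) (b w : List A) (g : ℕ) :
    |ν.real (pastSet t b ∩ pastSet (t - b.length - g) w) - wordProb ν b * wordProb ν w| ≤
      wordProb ν w * contractionRate K θ ^ g := by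
  have h1 := (inCone_wordProb_append hp hr hK hθ0 hθ1 b).abs_iterate_transfer_sub_le hp hr hK hθ0 hθ1
    (S := 1) (fun w => (div_le_one (hp.pos w)).2 (hp.append_le b w)) g w
  -- With the empty past, the iterate at `[]` is the unconditional probability of `b`.
  have h2 := real_pastSet_inter_pastSet hp h t b [] g
  rw [hp.nil, one_mul, pastSet, Set.inter_univ, h.real_pastSet] at h2
  rw [← h2, mul_one] at h1
  rw [real_pastSet_inter_pastSet hp h, mul_comm (wordProb ν b), ← mul_sub, abs_mul,
    abs_of_pos (hp.pos w)]
  exact mul_le_mul_of_nonneg_left h1 (hp.pos w).le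

/-- Exponential decay of `γ` gives the exponential dependence on the remote past. -/
lemma exists_hasExpRatio [Nonempty A] (hp : IsWordLaw (wordProb ν)) (h : IsStationary ν)
    (hB : ConditionB ν) {γ : ℕ → ℝ} (hC : ConditionC ν γ) (hexp : ExponentialDecay γ) :
    ∃ K θ : ℝ, HasExpRatio (wordProb ν) K θ ∧ 0 ≤ K ∧ 0 ≤ θ ∧ θ < 1 := by
  obtain ⟨M, hM, c, hc, hγ⟩ := hexp
  have hθ1 : Real.exp (-c) < 1 := Real.exp_lt_one_iff.2 (by linarith)
  -- Chosen so that `K (1 - θ) / 2 = M`; then `1 + γ ≤ exp γ` suffices.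
  refine ⟨2 * M / (1 - Real.exp (-c)), Real.exp (-c), fun a u v w => ?_,
    div_nonneg (by linarith) (by linarith), Real.exp_nonneg _, hθ1⟩
  refine (wordProb_div_le hp h hB hC a u v w).trans ?_
  refine mul_le_mul_of_nonneg_right ?_ (div_nonneg (hp.pos _).le (hp.pos _).le)
  have h1 := hγ u.length
  have e : 2 * M / (1 - Real.exp (-c)) * (1 - Real.exp (-c)) / 2 * Real.exp (-c) ^ u.length
      = M * Real.exp (-c * u.length) := by
    rw [div_mul_cancel₀ _ (by linarith), ← Real.exp_nat_mul]
    ring_nf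
  rw [e]
  have h2 := Real.add_one_le_exp (M * Real.exp (-c * u.length))
  linarith

end

/-! ### Conditional entropies: monotonicity, exponential convergence, strictness -/

section


variable {A : Type*} [Fintype A]

section PastRatio

variable {p : List A → ℝ}

/-- The effect of one more symbol of the past on the conditional probability. -/
noncomputable def pastRatio (p : List A → ℝ) (s : A) (w : List A) (r : A) : ℝ :=
  p (s :: (w ++ [r])) / p (w ++ [r]) / (p (s :: w) / p w)

lemma pastRatio_pos (hp : IsWordLaw p) (s : A) (w : List A) (r : A) :
    0 < pastRatio p s w r :=
  div_pos (div_pos (hp.pos _) (hp.pos _)) (div_pos (hp.pos _) (hp.pos _))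

/-- The inverse ratio has mean `1`: it turns the weight of `s, w, r` into `p (s :: w) / p w * p (w
++ [r])`, another probability vector. Adding this zero sum makes the entropy difference termwise
nonnegative in `condEntropy_sub_succ_eq`. -/
lemma sum_mul_one_sub_inv_pastRatio (hp : IsWordLaw p) (k : ℕ) :
    ∑ a : Fin k → A, ∑ s, ∑ r,
      p (s :: (word a ++ [r])) * (1 - (pastRatio p s (word a) r)⁻¹) = 0 := by
  refine Finset.sum_eq_zero fun a _ => Finset.sum_eq_zero fun s _ => ?_
  have e : ∀ r, p (s :: (word a ++ [r])) * (1 - (pastRatio p s (word a) r)⁻¹) =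
      p (s :: word a ++ [r]) -
        p (s :: word a) / p (word a) * p (word a ++ [r]) := fun r => by
    have h1 := (hp.pos (s :: (word a ++ [r]))).ne'
    have h2 := (hp.pos (word a ++ [r])).ne'
    rw [pastRatio, List.cons_append]
    field_simp
  simp only [e]
  rw [Finset.sum_sub_distrib, hp.append, ← Finset.mul_sum, hp.append,
    div_mul_cancel₀ _ (hp.pos _).ne', sub_self]

end PastRatio

variable [MeasurableSpace A] [DiscreteMeasurableSpace A] {ν : Measure (ℤ → A)}

lemma entropyH_eq_sum (h : IsStationary ν) (k : ℕ) : entropyH ν k =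
    -∑ a : Fin k → A, wordProb ν (word a) * Real.log (wordProb ν (word a)) := by
  simp only [entropyH, blockEntropy, marginal_eq_wordProb h]

lemma condEntropy_eq_sum_word (h : IsStationary ν) (k : ℕ) : condEntropy ν k =
    -∑ a : Fin (k + 1) → A, wordProb ν (word a) *
      Real.log (wordProb ν (word a) / wordProb ν (word a).tail) := by
  rw [condEntropy]
  congr 1
  refine Finset.sum_congr rfl fun a _ => ?_
  rw [marginal_eq_wordProb h, condProb_eq_wordProb h, word_last]
  rfl

lemma condEntropy_eq_sum (h : IsStationary ν) (k : ℕ) : condEntropy ν k =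
    -∑ a : Fin k → A, ∑ s, wordProb ν (s :: word a) *
      Real.log (wordProb ν (s :: word a) / wordProb ν (word a)) := by
  rw [condEntropy_eq_sum_word h,
    sum_word_last (fun l => wordProb ν l * Real.log (wordProb ν l / wordProb ν l.tail))]
  rfl

lemma entropyH_succ (hp : IsWordLaw (wordProb ν)) (h : IsStationary ν) (k : ℕ) :
    entropyH ν (k + 1) = entropyH ν k + condEntropy ν k := by
  rw [entropyH_eq_sum h, entropyH_eq_sum h, condEntropy_eq_sum h,
    sum_word_last (fun l => wordProb ν l * Real.log (wordProb ν l)), ← neg_add,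
    ← Finset.sum_add_distrib]
  congr 1
  refine Finset.sum_congr rfl fun a _ => ?_
  rw [← hp.cons (word a), Finset.sum_mul, ← Finset.sum_add_distrib]
  refine Finset.sum_congr rfl fun s _ => ?_
  rw [hp.cons, Real.log_div (hp.pos _).ne' (hp.pos _).ne']
  ring

lemma entropyH_eq_sum_condEntropy (hp : IsWordLaw (wordProb ν)) (h : IsStationary ν) (k : ℕ) :
    entropyH ν k = ∑ i ∈ Finset.range k, condEntropy ν i := by
  induction k with
  | zero => simp [entropyH_eq_sum h, word, hp.nil]
  | succ k ih => rw [entropyH_succ hp h, ih, Finset.sum_range_succ]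

lemma condEntropy_sub_succ (hp : IsWordLaw (wordProb ν)) (h : IsStationary ν) (k : ℕ) :
    condEntropy ν k - condEntropy ν (k + 1) = ∑ a : Fin k → A, ∑ s, ∑ r,
      wordProb ν (s :: (word a ++ [r])) * Real.log (pastRatio (wordProb ν) s (word a) r) := by
  rw [condEntropy_eq_sum h, condEntropy_eq_sum_word h,
    sum_word_first (fun l => wordProb ν l * Real.log (wordProb ν l / wordProb ν l.tail))]
  have e := sum_word_last (k := k) (fun l => ∑ r, wordProb ν (l ++ [r]) *
      Real.log (wordProb ν (l ++ [r]) / wordProb ν (l ++ [r]).tail))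
  rw [e, neg_sub_neg, ← Finset.sum_sub_distrib]
  refine Finset.sum_congr rfl fun a _ => ?_
  rw [← Finset.sum_sub_distrib]
  refine Finset.sum_congr rfl fun s _ => ?_
  rw [← hp.append (s :: word a), Finset.sum_mul, ← Finset.sum_sub_distrib]
  refine Finset.sum_congr rfl fun r _ => ?_
  rw [hp.append, pastRatio, Real.log_div (div_pos (hp.pos _) (hp.pos _)).ne'
    (div_pos (hp.pos _) (hp.pos _)).ne', mul_sub]
  rfl

lemma one_sub_inv_le_log {x : ℝ} (hx : 0 < x) : 1 - x⁻¹ ≤ Real.log x := by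
  have h := Real.log_le_sub_one_of_pos (inv_pos.2 hx)
  rw [Real.log_inv] at h
  linarith

lemma eq_one_of_log_eq {x : ℝ} (hx : 0 < x) (h : Real.log x = 1 - x⁻¹) : x = 1 := by
  by_contra hne
  have h1 := Real.log_lt_sub_one_of_pos (inv_pos.2 hx) (by simpa using hne)
  rw [Real.log_inv] at h1
  linarith

lemma condEntropy_sub_succ_eq (hp : IsWordLaw (wordProb ν)) (h : IsStationary ν) (k : ℕ) :
    condEntropy ν k - condEntropy ν (k + 1) = ∑ a : Fin k → A, ∑ s, ∑ r,
      wordProb ν (s :: (word a ++ [r])) *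
        (Real.log (pastRatio (wordProb ν) s (word a) r) - (1 - (pastRatio (wordProb ν) s (word a) r)⁻¹)) := by
  simp only [mul_sub (wordProb ν _) (Real.log _), Finset.sum_sub_distrib]
  rw [sum_mul_one_sub_inv_pastRatio hp, sub_zero, condEntropy_sub_succ hp h]

lemma antitone_condEntropy (hp : IsWordLaw (wordProb ν)) (h : IsStationary ν) :
    Antitone (condEntropy ν) := by
  refine antitone_nat_of_succ_le fun k => ?_
  rw [← sub_nonneg, condEntropy_sub_succ_eq hp h]
  exact Finset.sum_nonneg fun a _ => Finset.sum_nonneg fun s _ => Finset.sum_nonneg fun r _ =>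
    mul_nonneg (hp.pos _).le (sub_nonneg.2 (one_sub_inv_le_log (pastRatio_pos hp s _ r)))

/-- The equality case of Gibbs' inequality: a vanishing sum of nonnegative terms with positive
weights, and `log x = 1 - x⁻¹` only at `x = 1`. -/
lemma pastRatio_eq_one (hp : IsWordLaw (wordProb ν)) (h : IsStationary ν)
    (hconst : ∀ k, condEntropy ν k = condEntropy ν (k + 1)) (s : A) (w : List A) (r : A) :
    pastRatio (wordProb ν) s w r = 1 := by
  obtain ⟨a, ha⟩ := exists_word_eq w
  have h1 := condEntropy_sub_succ_eq hp h w.length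
  rw [← hconst, sub_self] at h1
  have hnn : ∀ (a : Fin w.length → A) s r, 0 ≤ wordProb ν (s :: (word a ++ [r])) *
        (Real.log (pastRatio (wordProb ν) s (word a) r) - (1 - (pastRatio (wordProb ν) s (word a) r)⁻¹)) :=
    fun a s r =>
    mul_nonneg (hp.pos _).le (sub_nonneg.2 (one_sub_inv_le_log (pastRatio_pos hp s _ r)))
  have h2 := (Finset.sum_eq_zero_iff_of_nonneg fun a _ => Finset.sum_nonneg fun s _ =>
    Finset.sum_nonneg fun r _ => hnn a s r).1 h1.symm a (Finset.mem_univ _)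
  have h3 := (Finset.sum_eq_zero_iff_of_nonneg fun s _ =>
    Finset.sum_nonneg fun r _ => hnn a s r).1 h2 s (Finset.mem_univ _)
  have h4 := (Finset.sum_eq_zero_iff_of_nonneg fun r _ => hnn a s r).1 h3 r (Finset.mem_univ _)
  rw [ha] at h4
  rcases mul_eq_zero.1 h4 with h5 | h5
  · exact absurd h5 (hp.pos _).ne'
  · exact eq_one_of_log_eq (pastRatio_pos hp s w r) (by linarith)

/-- If the conditional entropies are constant, then the process is independent, and `γ_0 = 0`. -/
lemma exists_condEntropy_ne [Nonempty A] (hp : IsWordLaw (wordProb ν)) (h : IsStationary ν)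
    (hB : ConditionB ν) {γ : ℕ → ℝ} (hC : ConditionC ν γ) (hγ : 0 < γ 0) :
    ∃ k, condEntropy ν k ≠ condEntropy ν (k + 1) := by
  by_contra! hconst
  -- A ratio equal to `1` allows the oldest symbol to be dropped, hence the induction from the end
  -- of the list.
  have h1 : ∀ s w, wordProb ν (s :: w) / wordProb ν w = wordProb ν [s] := by
    intro s w
    induction w using List.reverseRecOn with
    | nil => rw [hp.nil, div_one]
    | append_singleton w r ih =>
      rw [← ih]
      exact (div_eq_one_iff_eq (div_pos (hp.pos _) (hp.pos _)).ne').1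
        (pastRatio_eq_one hp h hconst s w r)
  have h2 : ∀ x, transition ν x = wordProb ν [x 0] := by
    intro x
    refine tendsto_nhds_unique (tendsto_transition h hB x) (tendsto_const_nhds.congr fun m => ?_)
    rw [List.range_succ_eq_map, List.map_cons, List.tail_cons, h1]
  refine hγ.not_ge ((hC.2.2 0).2 ?_)
  rintro r ⟨a, b, hab, rfl⟩
  rw [h2, h2, hab 0 le_rfl, div_self (hp.pos _).ne']
  simp

lemma condEntropy_sub_succ_le [IsProbabilityMeasure ν] (hp : IsWordLaw (wordProb ν))
    (h : IsStationary ν) {K θ : ℝ} (hr : HasExpRatio (wordProb ν) K θ) (k : ℕ) :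
    condEntropy ν k - condEntropy ν (k + 1) ≤ K * (1 - θ) / 2 * θ ^ k := by
  have h1 : ∑ a : Fin k → A, ∑ s, ∑ r, wordProb ν (s :: (word a ++ [r])) = 1 := by
    have e := sum_word_last (k := k) (fun l => ∑ r, wordProb ν (l ++ [r]))
    simp only [List.cons_append] at e
    rw [← e, ← sum_word_first]
    have : ∀ n, ∑ a : Fin n → A, wordProb ν (word a) = 1 := fun n => by
      induction n with
      | zero => simp [word, hp.nil]
      | succ n ih => rw [sum_word_last]; simpa only [hp.cons] using ih
    exact this _
  refine le_of_le_of_eq ?_ ((congrArg (· * (K * (1 - θ) / 2 * θ ^ k)) h1).trans (one_mul _))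
  rw [condEntropy_sub_succ hp h]
  simp only [Finset.sum_mul]
  refine Finset.sum_le_sum fun a _ => Finset.sum_le_sum fun s _ => Finset.sum_le_sum fun r _ =>
    mul_le_mul_of_nonneg_left ?_ (hp.pos _).le
  rw [Real.log_le_iff_le_exp (pastRatio_pos hp s _ r), pastRatio,
    div_le_iff₀ (div_pos (hp.pos _) (hp.pos _))]
  simpa using hr s (word a) [r] []

/-- The conditional entropies converge to the entropy, and exponentially fast. -/
lemma exists_tendsto_condEntropy [IsProbabilityMeasure ν] (hp : IsWordLaw (wordProb ν))
    (h : IsStationary ν) {K θ : ℝ} (hr : HasExpRatio (wordProb ν) K θ) (hK : 0 ≤ K)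
    (hθ0 : 0 ≤ θ) :
    ∃ e, Tendsto (condEntropy ν) atTop (𝓝 e) ∧ (∀ k, e ≤ condEntropy ν k) ∧
      ∀ k, condEntropy ν k - e ≤ K / 2 * θ ^ k := by
  have hanti := antitone_condEntropy hp h
  -- The one-step bound equals `K / 2 * (θ ^ k - θ ^ (k + 1))` and telescopes.
  have hstep : ∀ k j, condEntropy ν k - condEntropy ν (k + j) ≤ K / 2 * (θ ^ k - θ ^ (k + j)) := by
    intro k j
    induction j with
    | zero => simp
    | succ j ih =>
      have h1 := condEntropy_sub_succ_le hp h hr (k + j)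
      rw [← add_assoc, pow_succ]
      linarith
  have hbd : ∀ k j, condEntropy ν k - K / 2 * θ ^ k ≤ condEntropy ν (k + j) := fun k j => by
    have h1 := hstep k j
    have : 0 ≤ K / 2 * θ ^ (k + j) := by positivity
    linarith
  have hbdd : BddBelow (Set.range (condEntropy ν)) := by
    refine ⟨condEntropy ν 0 - K / 2 * θ ^ 0, ?_⟩
    rintro _ ⟨j, rfl⟩
    simpa using hbd 0 j
  have hlim := tendsto_atTop_ciInf hanti hbdd
  refine ⟨_, hlim, fun k => ciInf_le hbdd k, fun k => ?_⟩
  have h2 := ge_of_tendsto ((tendsto_add_atTop_iff_nat k).2 hlim)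
    (Eventually.of_forall fun j => by rw [add_comm]; exact hbd k j)
  linarith

/-- The entropies of the blocks determine the entropy rate; the sum of the differences of the
conditional entropies from their limit converges to a positive value. -/
lemma entropy_convergence [Nonempty A] [IsProbabilityMeasure ν] (hp : IsWordLaw (wordProb ν))
    (h : IsStationary ν) (hB : ConditionB ν) {γ : ℕ → ℝ} (hC : ConditionC ν γ) (hγ : 0 < γ 0)
    {K θ : ℝ} (hr : HasExpRatio (wordProb ν) K θ) (hK : 0 ≤ K) (hθ0 : 0 ≤ θ) (hθ1 : θ < 1) :
    Tendsto (fun j : ℕ => entropyH ν j / (j : ℝ)) atTop (𝓝 (entropyRate ν)) ∧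
      Tendsto (fun j : ℕ => condEntropy ν j) atTop (𝓝 (entropyRate ν)) ∧
      Summable (fun i : ℕ => condEntropy ν i - entropyRate ν) ∧
      0 < ∑' i : ℕ, (condEntropy ν i - entropyRate ν) := by
  obtain ⟨e, he, hle, hge⟩ := exists_tendsto_condEntropy hp h hr hK hθ0
  have h1 : Tendsto (fun j : ℕ => entropyH ν j / (j : ℝ)) atTop (𝓝 e) := by
    refine he.cesaro.congr fun k => ?_
    rw [entropyH_eq_sum_condEntropy hp h, div_eq_inv_mul]
  have h2 : entropyRate ν = e := h1.limUnder_eq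
  rw [h2]
  have hnn : ∀ i, 0 ≤ condEntropy ν i - e := fun i => sub_nonneg.2 (hle i)
  have hsum : Summable (fun i : ℕ => condEntropy ν i - e) :=
    Summable.of_nonneg_of_le hnn hge ((summable_geometric_of_lt_one hθ0 hθ1).mul_left _)
  refine ⟨h1, he, hsum, ?_⟩
  obtain ⟨k, hk⟩ := exists_condEntropy_ne hp h hB hC hγ
  have h3 : condEntropy ν (k + 1) < condEntropy ν k :=
    lt_of_le_of_ne (antitone_condEntropy hp h k.le_succ) hk.symm
  exact hsum.tsum_pos hnn k (by linarith [hle (k + 1)])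

lemma tendsto_entropyH_sub [IsProbabilityMeasure ν] (hp : IsWordLaw (wordProb ν))
    (h : IsStationary ν) {e : ℝ} (hs : Summable (fun i : ℕ => condEntropy ν i - e)) :
    Tendsto (fun k : ℕ => entropyH ν k - k * e) atTop (𝓝 (∑' i : ℕ, (condEntropy ν i - e))) := by
  refine hs.hasSum.tendsto_sum_nat.congr fun k => ?_
  rw [entropyH_eq_sum_condEntropy hp h, Finset.sum_sub_distrib]
  simp

end

/-! ### Variance of word frequencies and the mean error of the empirical entropy -/

section


section Variance

variable {Ω : Type*} [MeasurableSpace Ω] {μ : Measure Ω}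

/-- With truncated subtraction `(i - j) + (j - i)` is `|i - j|`, and each distance from `i` occurs
at most once on either side. -/
lemma sum_sub_le_tsum {r : ℕ → ℝ} (hr : Summable r) (hr0 : ∀ d, 0 ≤ r d) (s : Finset ℕ) (i : ℕ) :
    ∑ j ∈ s, r ((i - j) + (j - i)) ≤ 2 * ∑' d, r d := by
  have h1 : ∀ (t : Finset ℕ) (f : ℕ → ℕ), Set.InjOn f t → ∑ j ∈ t, r (f j) ≤ ∑' d, r d := by
    intro t f hf
    rw [← Finset.sum_image (f := r) hf]
    exact hr.sum_le_tsum _ fun d _ => hr0 d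
  rw [← Finset.sum_filter_add_sum_filter_not s (fun j => i ≤ j), two_mul]
  refine add_le_add (h1 _ _ ?_) (h1 _ _ ?_) <;>
  · intro a ha b hb hab
    simp at ha hb hab
    omega

/-- The variance of a frequency of events with summable correlations. -/
lemma integral_sq_sum_indicator_le [IsProbabilityMeasure μ] {C : ℕ → Set Ω}
    (hC : ∀ i, MeasurableSet (C i)) {p : ℝ} (hp : 0 ≤ p) (hCp : ∀ i, μ.real (C i) = p) {r : ℕ → ℝ}
    (hr : Summable r) (hr0 : ∀ d, 0 ≤ r d)
    (hcov : ∀ i j, i ≤ j → μ.real (C i ∩ C j) - p * p ≤ p * r (j - i)) {N : ℕ} (hN : 0 < N) :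
    ∫ x, ((∑ i ∈ Finset.Icc 1 N, (C i).indicator (fun _ => (1 : ℝ)) x) / (N : ℝ) - p) ^ 2 ∂μ ≤
      2 * p * (∑' d, r d) / N := by
  have hN0 : (0 : ℝ) < N := by exact_mod_cast hN
  have hcov' : ∀ i j, μ.real (C i ∩ C j) - p * p ≤ p * r ((i - j) + (j - i)) := by
    intro i j
    rcases le_total i j with h | h
    · simpa [Nat.sub_eq_zero_of_le h] using hcov i j h
    · rw [Set.inter_comm]
      simpa [Nat.sub_eq_zero_of_le h] using hcov j i h
  have hint : ∀ (s : Set Ω) (c : ℝ), MeasurableSet s →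
      Integrable (fun x => c * s.indicator (fun _ => (1 : ℝ)) x) μ := fun s c hs =>
    ((integrable_const (1 : ℝ)).indicator hs).const_mul c
  have hval : ∀ (s : Set Ω), MeasurableSet s →
      ∫ x, s.indicator (fun _ => (1 : ℝ)) x ∂μ = μ.real s := fun s hs => by
    rw [integral_indicator_const _ hs, smul_eq_mul, mul_one]
  -- The product of the two centred indicators, expanded; the factor `1` lets `hint` cover every
  -- indicator term.
  set f : ℕ → ℕ → Ω → ℝ := fun i j x => 1 * (C i ∩ C j).indicator (fun _ => (1 : ℝ)) x -
      p * (C i).indicator (fun _ => (1 : ℝ)) x - p * (C j).indicator (fun _ => (1 : ℝ)) x + p * p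
  have e1 : ∀ x, ((∑ i ∈ Finset.Icc 1 N, (C i).indicator (fun _ => (1 : ℝ)) x) / (N : ℝ) - p) ^ 2 =
      (∑ i ∈ Finset.Icc 1 N, ∑ j ∈ Finset.Icc 1 N, f i j x) / (N : ℝ) ^ 2 := by
    intro x
    have e2 : ∀ i j, f i j x = ((C i).indicator (fun _ => (1 : ℝ)) x - p) *
        ((C j).indicator (fun _ => (1 : ℝ)) x - p) := by
      intro i j
      have h := Set.inter_indicator_mul (s := C i) (t := C j)
        (fun _ : Ω => (1 : ℝ)) (fun _ => 1) x
      simp only [mul_one] at h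
      simp only [f, h]
      ring
    simp only [e2]
    rw [← Finset.sum_mul_sum, Finset.sum_sub_distrib, ← sq, ← div_pow]
    congr 1
    simp only [Finset.sum_const, Nat.card_Icc, Nat.add_sub_cancel, nsmul_eq_mul]
    field_simp
  have hfint : ∀ i j, Integrable (f i j) μ := fun i j =>
    (((hint _ 1 ((hC i).inter (hC j))).sub (hint _ p (hC i))).sub (hint _ p (hC j))).add
      (integrable_const _)
  have hfval : ∀ i j, ∫ x, f i j x ∂μ = μ.real (C i ∩ C j) - p * p := by
    intro i j
    have h1 := hint _ 1 ((hC i).inter (hC j))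
    have h2 := hint _ p (hC i)
    have h3 := hint _ p (hC j)
    have h12 : Integrable (fun x => 1 * (C i ∩ C j).indicator (fun _ => (1 : ℝ)) x -
      p * (C i).indicator (fun _ => (1 : ℝ)) x) μ := h1.sub h2
    have h123 : Integrable (fun x => 1 * (C i ∩ C j).indicator (fun _ => (1 : ℝ)) x -
      p * (C i).indicator (fun _ => (1 : ℝ)) x - p * (C j).indicator (fun _ => (1 : ℝ)) x) μ :=
      h12.sub h3
    simp only [f]
    rw [integral_add h123 (integrable_const _), integral_sub h12 h3,
      integral_sub h1 h2, integral_const_mul, integral_const_mul, integral_const_mul,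
      hval _ ((hC i).inter (hC j)), hval _ (hC i), hval _ (hC j), hCp, hCp]
    simp
  simp only [e1]
  rw [integral_div, integral_finsetSum _ fun i _ => integrable_finsetSum _ fun j _ => hfint i j]
  have h4 : ∑ i ∈ Finset.Icc 1 N, ∫ x, ∑ j ∈ Finset.Icc 1 N, f i j x ∂μ ≤
      N * (p * (2 * ∑' d, r d)) := by
    calc _ ≤ ∑ i ∈ Finset.Icc 1 N, p * (2 * ∑' d, r d) := by
          refine Finset.sum_le_sum fun i _ => ?_
          rw [integral_finsetSum _ fun j _ => hfint i j]
          simp only [hfval]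
          refine (Finset.sum_le_sum fun j _ => hcov' i j).trans ?_
          rw [← Finset.mul_sum]
          exact mul_le_mul_of_nonneg_left (sum_sub_le_tsum hr hr0 _ _) hp
      _ = _ := by simp
  rw [div_le_div_iff₀ (by positivity) hN0]
  calc _ ≤ N * (p * (2 * ∑' d, r d)) * N := mul_le_mul_of_nonneg_right h4 hN0.le
    _ = _ := by ring

/-- Integrate the weighted arithmetic-geometric mean inequality `|f| ≤ (f² / √V + √V) / 2`. -/
lemma integral_abs_le_sqrt [IsProbabilityMeasure μ] {f : Ω → ℝ} (hf : Integrable f μ)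
    (hf2 : Integrable (fun x => f x ^ 2) μ) {V : ℝ} (hV : 0 < V) (h : ∫ x, f x ^ 2 ∂μ ≤ V) :
    ∫ x, |f x| ∂μ ≤ √V := by
  have hs : 0 < √V := Real.sqrt_pos.2 hV
  have h1 : ∀ x, |f x| ≤ (f x ^ 2 / √V + √V) / 2 := by
    intro x
    have h2 : f x ^ 2 / √V * √V = f x ^ 2 := div_mul_cancel₀ _ hs.ne'
    have h3 : 0 ≤ f x ^ 2 / √V := by positivity
    rw [← sq_abs] at h2 h3 ⊢
    nlinarith [sq_nonneg (|f x| - √V), sq_nonneg (|f x|)]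
  have hi : Integrable (fun x => (f x ^ 2 / √V + √V) / 2) μ :=
    ((hf2.div_const _).add (integrable_const _)).div_const _
  calc ∫ x, |f x| ∂μ ≤ ∫ x, (f x ^ 2 / √V + √V) / 2 ∂μ := integral_mono hf.abs hi h1
    _ = ((∫ x, f x ^ 2 ∂μ) / √V + √V) / 2 := by
      rw [integral_div, integral_add (hf2.div_const _) (integrable_const _), integral_div]
      simp
    _ ≤ (V / √V + √V) / 2 := by gcongr
    _ = √V := by rw [Real.div_sqrt]; ring

end Variance

/-- First-order expansion of `x log x` at `p`. By convexity the remainder `e log (e/p) - (e - p)` is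
nonnegative, and `log x ≤ x - 1` bounds it by the chi-square term. -/
lemma abs_mul_log_sub_le {e p : ℝ} (he : 0 ≤ e) (hp : 0 < p) :
    |e * Real.log e - p * Real.log p| ≤ |e - p| * (|Real.log p| + 1) + (e - p) ^ 2 / p := by
  have key : 0 ≤ e * Real.log e - e * Real.log p - (e - p) ∧
      e * Real.log e - e * Real.log p - (e - p) ≤ (e - p) ^ 2 / p := by
    rcases he.eq_or_lt with rfl | he
    · constructor
      · simp [hp.le]
      · rw [le_div_iff₀ hp]; simp [sq]
    · have e1 : e * Real.log e - e * Real.log p = e * Real.log (e / p) := by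
        rw [Real.log_div he.ne' hp.ne']; ring
      have h1 := Real.log_le_sub_one_of_pos (div_pos he hp)
      have h2 := Real.log_le_sub_one_of_pos (div_pos hp he)
      rw [← inv_div, Real.log_inv] at h2
      rw [e1]
      constructor
      · have h3 : e * (p / e) = p := by field_simp
        rw [inv_div] at h2
        nlinarith
      · have h3 : e * (e / p - 1) - (e - p) = (e - p) ^ 2 / p := by field_simp
        nlinarith [mul_le_mul_of_nonneg_left h1 he.le]
  have e2 : e * Real.log e - p * Real.log p = (e - p) * (Real.log p + 1) +
      (e * Real.log e - e * Real.log p - (e - p)) := by ring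
  rw [e2]
  refine (abs_add_le _ _).trans (add_le_add ?_ ?_)
  · rw [abs_mul]
    exact mul_le_mul_of_nonneg_left ((abs_add_le _ _).trans (by simp)) (abs_nonneg _)
  · rw [abs_of_nonneg key.1]
    exact key.2

/-- Makes the error uniform over words, however small their probability. It is `1 - x⁻¹ ≤ log x` at
`x = √p`. -/
lemma sqrt_mul_abs_log_add_one_le {p : ℝ} (hp : 0 < p) (hp1 : p ≤ 1) :
    √p * (|Real.log p| + 1) ≤ 2 := by
  have hs : 0 < √p := Real.sqrt_pos.2 hp
  have h1 := one_sub_inv_le_log hs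
  have h2 : √p * (√p)⁻¹ = 1 := mul_inv_cancel₀ hs.ne'
  rw [Real.log_sqrt hp.le] at h1
  rw [abs_of_nonpos (Real.log_nonpos hp.le hp1)]
  nlinarith

section Empirical

variable {A : Type*}

lemma empirical_nonneg (x : ℤ → A) (n k : ℕ) (a : Fin k → A) : 0 ≤ empirical x n k a :=
  div_nonneg (Finset.sum_nonneg fun _ _ => Set.indicator_nonneg (fun _ _ => zero_le_one) _)
    (Nat.cast_nonneg _)

lemma empirical_le_one (x : ℤ → A) (n k : ℕ) (a : Fin k → A) : empirical x n k a ≤ 1 := by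
  refine div_le_one_of_le₀ ?_ (Nat.cast_nonneg _)
  calc _ ≤ ∑ i ∈ Finset.Icc 1 (n + 1 - k), (1 : ℝ) :=
        Finset.sum_le_sum fun _ _ => Set.indicator_le_self' (fun _ _ => zero_le_one) _
    _ = _ := by simp

lemma measurable_empirical [MeasurableSpace A] [DiscreteMeasurableSpace A]
    (n k : ℕ) (a : Fin k → A) :
    Measurable fun x : ℤ → A => empirical x n k a := by
  unfold empirical
  refine Measurable.div_const (Finset.measurable_sum _ fun i _ => ?_) _
  rw [cylinder_eq_pastSet]
  exact measurable_const.indicator (measurableSet_pastSet _ _)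

end Empirical

variable {A : Type*} [MeasurableSpace A] [DiscreteMeasurableSpace A] {ν : Measure (ℤ → A)}

/-- The bound on the correlations of two occurrences of a word of length `k` at distance `d`. -/
noncomputable def corrBound (k : ℕ) (ρ : ℝ) (d : ℕ) : ℝ := if d < k then 1 else ρ ^ (d - k)

lemma corrBound_nonneg (k : ℕ) {ρ : ℝ} (h0 : 0 ≤ ρ) (d : ℕ) : 0 ≤ corrBound k ρ d := by
  rw [corrBound]
  split_ifs
  · exact zero_le_one
  · positivity

lemma hasSum_corrBound (k : ℕ) {ρ : ℝ} (h0 : 0 ≤ ρ) (h1 : ρ < 1) :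
    HasSum (corrBound k ρ) (k + (1 - ρ)⁻¹) := by
  rw [add_comm, ← hasSum_nat_add_iff' k]
  have e1 : ∑ i ∈ Finset.range k, corrBound k ρ i = k := by
    have e : ∀ i ∈ Finset.range k, corrBound k ρ i = 1 := fun i hi =>
      if_pos (Finset.mem_range.1 hi)
    rw [Finset.sum_congr rfl e]
    simp
  rw [e1, add_sub_cancel_right]
  have e2 : (fun n => corrBound k ρ (n + k)) = fun n => ρ ^ n := by
    funext n
    simp [corrBound]
  rw [e2]
  exact hasSum_geometric_of_lt_one h0 h1

/-- The law of the process mixes exponentially fast, at the rate `ρ`. -/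
def IsMixing (ν : Measure (ℤ → A)) (ρ : ℝ) : Prop :=
  ∀ (t : ℤ) (b w : List A) (g : ℕ),
    |ν.real (pastSet t b ∩ pastSet (t - b.length - g) w) - wordProb ν b * wordProb ν w| ≤
      wordProb ν w * ρ ^ g

/-- Overlapping occurrences are bounded trivially by the probability of one of them; otherwise
mixing applies across a gap of length `j - i - k`. -/
lemma IsMixing.real_cylinder_inter_sub_le [IsProbabilityMeasure ν] (h : IsStationary ν) {ρ : ℝ} (hm : IsMixing ν ρ) {k : ℕ} (a : Fin k → A) {i j : ℕ}
    (hij : i ≤ j) : ν.real (cylinder (i : ℤ) a ∩ cylinder (j : ℤ) a) -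
      wordProb ν (word a) * wordProb ν (word a) ≤ wordProb ν (word a) * corrBound k ρ (j - i) := by
  rw [cylinder_eq_pastSet, cylinder_eq_pastSet, corrBound]
  split_ifs with hd
  · have h1 : ν.real (pastSet (i + k - 1) (word a) ∩ pastSet (j + k - 1) (word a)) ≤
        wordProb ν (word a) := by
      rw [← h.real_pastSet (i + k - 1 : ℤ)]
      exact measureReal_mono Set.inter_subset_left
    linarith [mul_self_nonneg (wordProb ν (word a))]
  · have h1 := hm (j + k - 1) (word a) (word a) (j - i - k)
    have e : ((j : ℤ) + k - 1) - (word a).length - ((j - i - k : ℕ) : ℤ) = i + k - 1 := by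
      rw [length_word]
      omega
    rw [e, Set.inter_comm] at h1
    exact (le_abs_self _).trans h1

lemma measurable_empiricalEntropy [Fintype A] (n k : ℕ) :
    Measurable fun x : ℤ → A => empiricalEntropy x n k := by
  unfold empiricalEntropy blockEntropy
  have := measurable_empirical (A := A) n k
  fun_prop

lemma integrable_empirical_sub [IsProbabilityMeasure ν] (n k : ℕ) (a : Fin k → A) (c : ℝ) :
    Integrable (fun x => empirical x n k a - c) ν :=
  (Integrable.of_bound (measurable_empirical n k a).aestronglyMeasurable 1
    (Eventually.of_forall fun x => by
      rw [Real.norm_of_nonneg (empirical_nonneg x n k a)]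
      exact empirical_le_one x n k a)).sub (integrable_const c)

lemma integrable_sq_empirical_sub [IsProbabilityMeasure ν] (n k : ℕ) (a : Fin k → A) (c : ℝ) :
    Integrable (fun x => (empirical x n k a - c) ^ 2) ν :=
  Integrable.of_bound (((measurable_empirical n k a).sub_const c).pow_const 2).aestronglyMeasurable
    ((1 + |c|) ^ 2) (Eventually.of_forall fun x => by
      rw [norm_pow]
      refine pow_le_pow_left₀ (norm_nonneg _) ((norm_sub_le _ _).trans ?_) 2
      rw [Real.norm_of_nonneg (empirical_nonneg x n k a), Real.norm_eq_abs]
      linarith [empirical_le_one x n k a])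

/-- The mean error of the empirical entropy of order `k`. -/
lemma IsMixing.integral_abs_empiricalEntropy_sub_le [Fintype A] [IsProbabilityMeasure ν]
    (hp : IsWordLaw (wordProb ν)) (h : IsStationary ν) {ρ : ℝ} (hm : IsMixing ν ρ) (h0 : 0 ≤ ρ)
    (h1 : ρ < 1) {n k : ℕ} (hkn : k ≤ n) :
    Integrable (fun x => |empiricalEntropy x n k - entropyH ν k|) ν ∧
    ∫ x, |empiricalEntropy x n k - entropyH ν k| ∂ν ≤ (Fintype.card A : ℝ) ^ k *
      (2 * √(2 * (k + (1 - ρ)⁻¹) / (n + 1 - k : ℕ)) + 2 * (k + (1 - ρ)⁻¹) / (n + 1 - k : ℕ)) := by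
  have hN : 0 < n + 1 - k := by omega
  set N := n + 1 - k with hNdef
  have hN0 : (0 : ℝ) < N := by exact_mod_cast hN
  set R : ℝ := k + (1 - ρ)⁻¹ with hR
  have hR0 : 0 < R := by
    have : 0 < (1 - ρ)⁻¹ := inv_pos.2 (by linarith)
    positivity
  have hvar : ∀ a : Fin k → A, ∫ x, (empirical x n k a - wordProb ν (word a)) ^ 2 ∂ν ≤
      wordProb ν (word a) * (2 * R / N) := fun a => by
    have h2 := integral_sq_sum_indicator_le (μ := ν) (C := fun i : ℕ => cylinder (i : ℤ) a)
      (fun i => by rw [cylinder_eq_pastSet]; exact measurableSet_pastSet _ _)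
      (hp.pos (word a)).le (fun i => by rw [cylinder_eq_pastSet, h.real_pastSet])
      (hasSum_corrBound k h0 h1).summable (corrBound_nonneg k h0)
      (fun i j hij => hm.real_cylinder_inter_sub_le h a hij) hN
    rw [(hasSum_corrBound k h0 h1).tsum_eq] at h2
    exact h2.trans_eq (by ring)
  have hpt : ∀ x, |empiricalEntropy x n k - entropyH ν k| ≤ ∑ a : Fin k → A,
      (|empirical x n k a - wordProb ν (word a)| * (|Real.log (wordProb ν (word a))| + 1) +
        (empirical x n k a - wordProb ν (word a)) ^ 2 / wordProb ν (word a)) := by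
    intro x
    rw [empiricalEntropy, blockEntropy, entropyH_eq_sum h, neg_sub_neg, abs_sub_comm,
      ← Finset.sum_sub_distrib]
    exact (Finset.abs_sum_le_sum_abs _ _).trans (Finset.sum_le_sum fun a _ =>
      abs_mul_log_sub_le (empirical_nonneg x n k a) (hp.pos _))
  have hi1 : ∀ a : Fin k → A, Integrable (fun x => |empirical x n k a - wordProb ν (word a)| *
      (|Real.log (wordProb ν (word a))| + 1)) ν :=
    fun a => (integrable_empirical_sub n k a _).abs.mul_const _
  have hi2 : ∀ a : Fin k → A, Integrable (fun x =>
      (empirical x n k a - wordProb ν (word a)) ^ 2 / wordProb ν (word a)) ν :=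
    fun a => (integrable_sq_empirical_sub n k a _).div_const _
  have hi : Integrable (fun x => ∑ a : Fin k → A,
      (|empirical x n k a - wordProb ν (word a)| * (|Real.log (wordProb ν (word a))| + 1) +
        (empirical x n k a - wordProb ν (word a)) ^ 2 / wordProb ν (word a))) ν :=
    integrable_finsetSum _ fun a _ => (hi1 a).add (hi2 a)
  have hi0 : Integrable (fun x => |empiricalEntropy x n k - entropyH ν k|) ν :=
    hi.mono' ((measurable_empiricalEntropy n k).sub_const _).abs.aestronglyMeasurable
      (Eventually.of_forall fun x => by rw [Real.norm_eq_abs, abs_abs]; exact hpt x)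
  refine ⟨hi0, (integral_mono hi0 hi hpt).trans ?_⟩
  have hi12 : ∀ a : Fin k → A, Integrable (fun x => |empirical x n k a - wordProb ν (word a)| *
      (|Real.log (wordProb ν (word a))| + 1) +
        (empirical x n k a - wordProb ν (word a)) ^ 2 / wordProb ν (word a)) ν :=
    fun a => (hi1 a).add (hi2 a)
  rw [integral_finsetSum _ fun a _ => hi12 a]
  -- The bound is free of `a`: the variance is proportional to the probability of the word, which
  -- cancels in the quadratic term and leaves its square root against the logarithm in the linear
  -- one.
  have hterm : ∀ a : Fin k → A, ∫ x, (|empirical x n k a - wordProb ν (word a)| *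
      (|Real.log (wordProb ν (word a))| + 1) +
        (empirical x n k a - wordProb ν (word a)) ^ 2 / wordProb ν (word a)) ∂ν ≤
      2 * √(2 * R / N) + 2 * R / N := by
    intro a
    rw [integral_add (hi1 a) (hi2 a), integral_mul_const, integral_div]
    have hpa := hp.pos (word a)
    refine add_le_add ?_ ?_
    · have h2 := integral_abs_le_sqrt (integrable_empirical_sub n k a _)
        (integrable_sq_empirical_sub n k a _)
        (show 0 < wordProb ν (word a) * (2 * R / N) by positivity) (hvar a)
      rw [Real.sqrt_mul hpa.le] at h2
      calc _ ≤ (√(wordProb ν (word a)) * √(2 * R / N)) * (|Real.log (wordProb ν (word a))| + 1) :=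
            mul_le_mul_of_nonneg_right h2 (by positivity)
        _ = (√(wordProb ν (word a)) * (|Real.log (wordProb ν (word a))| + 1)) * √(2 * R / N) := by
            ring
        _ ≤ _ := mul_le_mul_of_nonneg_right (sqrt_mul_abs_log_add_one_le hpa (hp.le_one _))
            (Real.sqrt_nonneg _)
    · rw [div_le_iff₀ hpa, mul_comm]
      exact hvar a
  refine (Finset.sum_le_sum fun a _ => hterm a).trans_eq ?_
  rw [Finset.sum_const, nsmul_eq_mul]
  simp only [Finset.card_univ, Fintype.card_fun, Fintype.card_fin, Nat.cast_pow]

end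

/-! ### Growth of the word length, scaling, and convergence in probability -/

section


/-- If `k` grows more slowly than `log n / (2 log c)`, then there are far fewer than `√n` words
of length `k n` in `c` letters. -/
lemma tendsto_pow_mul_div {c : ℕ} (hc : 0 < c) {k : ℕ → ℕ} (hk : ∀ n, 0 < k n)
    (hklog : limsup (fun n : ℕ => (((k n : ℝ) / Real.log n : ℝ) : EReal)) atTop
      < ((1 / (2 * Real.log c) : ℝ) : EReal)) {D : ℝ} (hD : 0 ≤ D) :
    (∀ᶠ n in atTop, k n ≤ n) ∧
      Tendsto (fun n => (c : ℝ) ^ (2 * k n) * (2 * (k n + D) / (n + 1 - k n : ℕ)))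
        atTop (𝓝 0) := by
  obtain ⟨β, hβ, hβ'⟩ := EReal.lt_iff_exists_real_btwn.1 hklog
  have hev : ∀ᶠ n : ℕ in atTop, (k n : ℝ) < β * Real.log n := by
    filter_upwards [eventually_lt_of_limsup_lt hβ, eventually_ge_atTop 2] with n hn h2
    have hlog : 0 < Real.log n := Real.log_pos (by exact_mod_cast h2)
    exact (div_lt_iff₀ hlog).1 (by exact_mod_cast hn)
  have hβ0 : 0 < β := by
    obtain ⟨n, hn, h2⟩ := (hev.and (eventually_ge_atTop 2)).exists
    have hlog : 0 < Real.log n := Real.log_pos (by exact_mod_cast h2)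
    have h3 : (0 : ℝ) < k n := by exact_mod_cast hk n
    exact pos_of_mul_pos_left (h3.trans hn) hlog.le
  have hβ1 : β < 1 / (2 * Real.log c) := by exact_mod_cast hβ'
  -- This excludes `c = 1`, where the bound `1 / (2 * Real.log c)` has the default value `0`.
  have hlogc : 0 < 2 * Real.log c := one_div_pos.1 (hβ0.trans hβ1)
  have hs : β * (2 * Real.log c) < 1 := (lt_div_iff₀ hlogc).1 hβ1
  set s := β * (2 * Real.log c) with hsdef
  have hhalf : ∀ᶠ n : ℕ in atTop, β * Real.log n ≤ n / 2 := by
    have h1 := (Real.isLittleO_log_id_atTop.comp_tendsto tendsto_natCast_atTop_atTop).def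
      (show (0 : ℝ) < 1 / (2 * β) by positivity)
    filter_upwards [h1] with n hn
    simp only [Function.comp_apply, id, Real.norm_eq_abs, Nat.abs_cast] at hn
    calc β * Real.log n ≤ β * (1 / (2 * β) * n) :=
          mul_le_mul_of_nonneg_left ((le_abs_self _).trans hn) hβ0.le
      _ = n / 2 := by field_simp
  have hkn : ∀ᶠ n : ℕ in atTop, (k n : ℝ) ≤ n / 2 := by
    filter_upwards [hev, hhalf] with n h1 h2 using h1.le.trans h2
  have hle : ∀ᶠ n in atTop, k n ≤ n := by
    filter_upwards [hkn] with n hn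
    have : (k n : ℝ) ≤ n := hn.trans (half_le_self (Nat.cast_nonneg n))
    exact_mod_cast this
  refine ⟨hle, ?_⟩
  have hlim : Tendsto (fun n : ℕ => 4 * β * (Real.log n / (n : ℝ) ^ (1 - s)) +
      4 * D * (n : ℝ) ^ (-(1 - s))) atTop (𝓝 0) := by
    have h1 := (isLittleO_log_rpow_atTop (sub_pos.2 hs)).tendsto_div_nhds_zero.comp
      tendsto_natCast_atTop_atTop
    have h2 := (tendsto_rpow_neg_atTop (sub_pos.2 hs)).comp tendsto_natCast_atTop_atTop
    simpa using (h1.const_mul (4 * β)).add (h2.const_mul (4 * D))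
  refine squeeze_zero' (Eventually.of_forall fun n => by positivity) ?_ hlim
  filter_upwards [hev, hkn, hle, eventually_ge_atTop 2] with n h1 h2 h3 h4
  have hn0 : (0 : ℝ) < n := by exact_mod_cast (by omega : 0 < n)
  have hc0 : (0 : ℝ) < c := by exact_mod_cast hc
  -- From `k n < β log n`; the exponent `s = 2 β log c` is below `1`, which leaves a positive power
  -- of `n` to beat the logarithm.
  have hpow : (c : ℝ) ^ (2 * k n) ≤ (n : ℝ) ^ s := by
    rw [← Real.rpow_natCast, Real.rpow_def_of_pos hc0, Real.rpow_def_of_pos hn0, Real.exp_le_exp,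
      hsdef]
    push_cast
    nlinarith
  have hN : (n : ℝ) / 2 ≤ (n + 1 - k n : ℕ) := by
    rw [Nat.cast_sub (by omega)]
    push_cast
    linarith
  calc (c : ℝ) ^ (2 * k n) * (2 * (k n + D) / (n + 1 - k n : ℕ))
      ≤ (n : ℝ) ^ s * (2 * (β * Real.log n + D) / (n / 2)) := by
        have : 0 ≤ β * Real.log n := (Nat.cast_nonneg (k n)).trans h1.le
        gcongr
    _ = 4 * (β * Real.log n + D) * ((n : ℝ) ^ s * (n : ℝ)⁻¹) := by field_simp; ring
    _ = 4 * (β * Real.log n + D) * (n : ℝ) ^ (-(1 - s)) := by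
        rw [← Real.rpow_neg_one, ← Real.rpow_add hn0]
        congr 2
        ring
    _ = _ := by
        rw [div_eq_mul_inv, ← Real.rpow_neg hn0.le]
        ring

section Scaling

variable {Ω ι : Type*} [MeasurableSpace Ω] {P : Measure Ω} {l : Filter ι} {Z : ι → Ω → ℝ}
  {r : ι → ℝ} {S β : ℝ}

lemma tendstoInMeasure_mul (hZ : TendstoInMeasure P Z l fun _ => S) (hr : Tendsto r l (𝓝 β)) :
    TendstoInMeasure P (fun i ω => r i * Z i ω) l fun _ => β * S := by
  rw [tendstoInMeasure_iff_dist] at hZ ⊢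
  intro ε hε
  have hδ : 0 < ε / 2 / (|β| + 1) := by positivity
  have h1 : ∀ᶠ i in l, |r i| < |β| + 1 :=
    (tendsto_order.1 hr.abs).2 _ (by linarith)
  have h2 : ∀ᶠ i in l, |(r i - β) * S| < ε / 2 := by
    have h3 : Tendsto (fun i => |(r i - β) * S|) l (𝓝 0) := by
      simpa using ((hr.sub_const β).mul_const S).abs
    exact (tendsto_order.1 h3).2 _ (by linarith)
  refine tendsto_of_tendsto_of_tendsto_of_le_of_le' tendsto_const_nhds (hZ _ hδ)
    (Eventually.of_forall fun _ => zero_le) ?_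
  filter_upwards [h1, h2] with i hi1 hi2
  refine measure_mono fun ω (hω : ε ≤ dist _ _) => ?_
  show ε / 2 / (|β| + 1) ≤ dist _ _
  rw [Real.dist_eq] at hω ⊢
  rw [div_le_iff₀ (by positivity)]
  have h3 : r i * Z i ω - β * S = (Z i ω - S) * r i + (r i - β) * S := by ring
  rw [h3] at hω
  have h4 := abs_add_le ((Z i ω - S) * r i) ((r i - β) * S)
  rw [abs_mul (Z i ω - S)] at h4
  have h5 := mul_le_mul_of_nonneg_left hi1.le (abs_nonneg (Z i ω - S))
  linarith

/-- Unless `Z` deviates from `S` by at least `S / 2`, it is at least `S / 2`, and the product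
exceeds any level once `r` is large. -/
lemma tendsto_measure_mul_lt (hZ : TendstoInMeasure P Z l fun _ => S) (hS : 0 < S)
    (hr : Tendsto r l atTop) (x : ℝ) : Tendsto (fun i => P {ω | r i * Z i ω < x}) l (𝓝 0) := by
  rw [tendstoInMeasure_iff_dist] at hZ
  refine tendsto_of_tendsto_of_tendsto_of_le_of_le' tendsto_const_nhds (hZ _ (half_pos hS))
    (Eventually.of_forall fun _ => zero_le) ?_
  filter_upwards [hr.eventually_ge_atTop (x / (S / 2)), hr.eventually_ge_atTop 0] with i h1 h2
  refine measure_mono fun ω (hω : r i * Z i ω < x) => ?_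
  show S / 2 ≤ dist _ _
  rw [Real.dist_eq, abs_sub_comm]
  by_contra! h3
  have h4 : S / 2 ≤ Z i ω := by linarith [le_abs_self (S - Z i ω)]
  rw [div_le_iff₀ (half_pos hS)] at h1
  linarith [mul_le_mul_of_nonneg_left h4 h2]

/-- Scaling does not turn convergence in probability to a positive constant into convergence in
distribution to a nondegenerate Gaussian law. -/
lemma not_tendstoInDistribution_gaussian [IsProbabilityMeasure P] {Z : ℕ → Ω → ℝ} {r : ℕ → ℝ}
    (hZ : TendstoInMeasure P Z atTop fun _ => S) (hS : 0 < S) (hr : ∀ n, 0 ≤ r n) (m : ℝ)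
    {v : NNReal} (hv : v ≠ 0) : ¬ TendstoInDistribution (fun n ω => r n * Z n ω) atTop (id : ℝ → ℝ)
      (fun _ => P) (gaussianReal m v) := by
  intro hd
  -- Nothing is known about the convergence of `r`; compactness of `[0, ∞]` provides a subsequence
  -- with a limit.
  obtain ⟨b, φ, hφ, hb⟩ := CompactSpace.tendsto_subseq (fun n => ENNReal.ofReal (r n))
  have hZφ : TendstoInMeasure P (fun n => Z (φ n)) atTop fun _ => S :=
    fun ε hε => (hZ ε hε).comp hφ.tendsto_atTop
  have hdφ := hd.tendsto.comp hφ.tendsto_atTop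
  have hatom := nullSingletonClass_gaussianReal (μ := m) hv
  by_cases hbt : b = ⊤
  · subst hbt
    have hrφ : Tendsto (fun n => r (φ n)) atTop atTop := ENNReal.tendsto_ofReal_nhds_top.1 hb
    have hlt := tendsto_measure_mul_lt hZφ hS hrφ
    -- All mass escapes to `+∞`, so the portmanteau inequality for open sets leaves none on any
    -- half-line.
    have hzero : ∀ x : ℝ, gaussianReal m v (Set.Iio x) = 0 := by
      intro x
      have h1 : (gaussianReal m v).map id (Set.Iio x) ≤
          liminf (fun n => (P.map fun ω => r (φ n) * Z (φ n) ω) (Set.Iio x)) atTop :=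
        ProbabilityMeasure.le_liminf_measure_open_of_tendsto hdφ isOpen_Iio
      have h2 : ∀ n, (P.map fun ω => r (φ n) * Z (φ n) ω) (Set.Iio x) =
          P {ω | r (φ n) * Z (φ n) ω < x} := fun n =>
        Measure.map_apply_of_aemeasurable (hd.forall_aemeasurable (φ n)) measurableSet_Iio
      simp only [h2, Measure.map_id] at h1
      rw [(hlt x).liminf_eq] at h1
      exact le_antisymm h1 zero_le
    have huniv : gaussianReal m v (⋃ n : ℕ, Set.Iio (n : ℝ)) = 0 :=
      measure_iUnion_null fun n => hzero n
    have hU : ⋃ n : ℕ, Set.Iio (n : ℝ) = Set.univ :=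
      Set.eq_univ_of_forall fun x => Set.mem_iUnion.2 (exists_nat_gt x)
    rw [hU] at huniv
    simp at huniv
  · have hrφ : Tendsto (fun n => r (φ n)) atTop (𝓝 b.toReal) := by
      have h1 := (ENNReal.tendsto_toReal hbt).comp hb
      refine h1.congr fun n => ?_
      simp [ENNReal.toReal_ofReal (hr (φ n))]
    -- For a finite limit the limit law is the point mass at `b.toReal * S`, whereas the Gaussian
    -- law has no atoms.
    have hm := (tendstoInMeasure_mul hZφ hrφ).tendstoInDistribution
      fun n => hd.forall_aemeasurable (φ n)
    have heq := tendsto_nhds_unique hdφ hm.tendsto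
    have h2 := congrArg (fun μ : ProbabilityMeasure ℝ => (μ : Measure ℝ) {b.toReal * S}) heq
    simp [Measure.map_const] at h2

end Scaling

variable {A : Type*} [Fintype A] [MeasurableSpace A] [DiscreteMeasurableSpace A]
  {ν : Measure (ℤ → A)}

/-- The empirical entropy of order `k n` is a consistent estimator of the entropy of order `k n`,
in the mean. -/
lemma tendsto_integral_abs_empiricalEntropy_sub [Nonempty A] [IsProbabilityMeasure ν]
    (hp : IsWordLaw (wordProb ν)) (h : IsStationary ν) {ρ : ℝ} (hm : IsMixing ν ρ) (h0 : 0 ≤ ρ)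
    (h1 : ρ < 1) {k : ℕ → ℕ} (hk : ∀ n, 0 < k n)
    (hklog : limsup (fun n : ℕ => (((k n : ℝ) / Real.log n : ℝ) : EReal)) atTop
      < ((1 / (2 * Real.log (Fintype.card A)) : ℝ) : EReal)) :
    (∀ᶠ n in atTop, k n ≤ n) ∧
    Tendsto (fun n => ∫ x, |empiricalEntropy x n (k n) - entropyH ν (k n)| ∂ν) atTop (𝓝 0) := by
  obtain ⟨hle, hlim⟩ := tendsto_pow_mul_div (Fintype.card_pos (α := A)) hk hklog
    (inv_nonneg.2 (sub_nonneg.2 h1.le))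
  refine ⟨hle, ?_⟩
  -- Moving `|A|^k` under the root turns it into `|A|^{2k}`; the other term is enlarged by `|A|^k ≤
  -- |A|^{2k}`, so one null sequence controls both.
  have hlim' := (hlim.sqrt.const_mul 2).add hlim
  rw [Real.sqrt_zero, mul_zero, add_zero] at hlim'
  refine squeeze_zero' (Eventually.of_forall fun n => integral_nonneg fun x => abs_nonneg _) ?_ hlim'
  filter_upwards [hle] with n hn
  refine (hm.integral_abs_empiricalEntropy_sub_le hp h h0 h1 hn).2.trans ?_
  have hc : (1 : ℝ) ≤ Fintype.card A := by exact_mod_cast Fintype.card_pos (α := A)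
  have hR : 0 ≤ 2 * (k n + (1 - ρ)⁻¹) / ((n + 1 - k n : ℕ) : ℝ) := by
    have : 0 ≤ (1 - ρ)⁻¹ := inv_nonneg.2 (sub_nonneg.2 h1.le)
    positivity
  rw [mul_add]
  refine add_le_add (le_of_eq ?_) (mul_le_mul_of_nonneg_right
    (pow_le_pow_right₀ hc (by omega)) hR)
  rw [Real.sqrt_mul (by positivity), mul_comm 2 (k n), pow_mul, Real.sqrt_sq (by positivity)]
  ring

/-- Split the deviation at `H_k`: Markov's inequality handles the random part, and the deterministic
part `H_k - k e - S` is eventually below `ε / 2`. -/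
lemma tendstoInMeasure_empiricalEntropy_sub [Nonempty A] {Ω : Type*} [MeasurableSpace Ω]
    {P : Measure Ω} [IsProbabilityMeasure P] {X : ℤ → Ω → A} (hX : ∀ i, Measurable (X i))
    (hν : ν = P.map (fun ω i => X i ω)) [IsProbabilityMeasure ν]
    (hp : IsWordLaw (wordProb ν)) (h : IsStationary ν) {ρ : ℝ} (hm : IsMixing ν ρ) (h0 : 0 ≤ ρ)
    (h1 : ρ < 1) {k : ℕ → ℕ} (hk : ∀ n, 0 < k n) (hktop : Tendsto k atTop atTop)
    (hklog : limsup (fun n : ℕ => (((k n : ℝ) / Real.log n : ℝ) : EReal)) atTop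
      < ((1 / (2 * Real.log (Fintype.card A)) : ℝ) : EReal)) {e : ℝ}
    (hs : Summable (fun i : ℕ => condEntropy ν i - e)) :
    TendstoInMeasure P (fun n ω => empiricalEntropy (fun i => X i ω) n (k n) - k n * e) atTop
      fun _ => ∑' i : ℕ, (condEntropy ν i - e) := by
  obtain ⟨hle, hlim⟩ := tendsto_integral_abs_empiricalEntropy_sub hp h hm h0 h1 hk hklog
  have hH := (tendsto_entropyH_sub hp h hs).comp hktop
  set S := ∑' i : ℕ, (condEntropy ν i - e)
  rw [tendstoInMeasure_iff_dist]
  intro ε hε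
  have hφ : Measurable fun ω i => X i ω := measurable_pi_lambda _ hX
  have hlim' : Tendsto (fun n => ENNReal.ofReal
      ((∫ x, |empiricalEntropy x n (k n) - entropyH ν (k n)| ∂ν) / (ε / 2))) atTop (𝓝 0) := by
    have h2 := ENNReal.tendsto_ofReal (hlim.div_const (ε / 2))
    rwa [zero_div, ENNReal.ofReal_zero] at h2
  refine tendsto_of_tendsto_of_tendsto_of_le_of_le' tendsto_const_nhds hlim'
    (Eventually.of_forall fun _ => zero_le) ?_
  filter_upwards [hle, Metric.tendsto_nhds.1 hH (ε / 2) (half_pos hε)] with n hn hSn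
  have hmeas : MeasurableSet {x : ℤ → A | ε / 2 ≤ |empiricalEntropy x n (k n) - entropyH ν (k n)|} :=
    measurableSet_le measurable_const ((measurable_empiricalEntropy n (k n)).sub_const _).abs
  calc P {ω | ε ≤ dist (empiricalEntropy (fun i => X i ω) n (k n) - k n * e) S}
      ≤ P ((fun ω i => X i ω) ⁻¹'
          {x | ε / 2 ≤ |empiricalEntropy x n (k n) - entropyH ν (k n)|}) := by
        refine measure_mono fun ω (hω : ε ≤ dist _ _) => ?_
        show ε / 2 ≤ |empiricalEntropy (fun i => X i ω) n (k n) - entropyH ν (k n)|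
        simp only [Function.comp_apply, Real.dist_eq] at hSn hω
        have h3 := abs_add_le (empiricalEntropy (fun i => X i ω) n (k n) - entropyH ν (k n))
          (entropyH ν (k n) - k n * e - S)
        rw [show empiricalEntropy (fun i => X i ω) n (k n) - entropyH ν (k n) +
          (entropyH ν (k n) - k n * e - S) =
          empiricalEntropy (fun i => X i ω) n (k n) - k n * e - S by ring] at h3
        linarith
    _ = ν {x | ε / 2 ≤ |empiricalEntropy x n (k n) - entropyH ν (k n)|} := by
        rw [hν, Measure.map_apply hφ (by rw [← hν]; exact hmeas)]
    _ ≤ _ := by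
        rw [← ofReal_measureReal]
        refine ENNReal.ofReal_le_ofReal ?_
        rw [le_div_iff₀ (half_pos hε), mul_comm]
        exact mul_meas_ge_le_integral_of_nonneg (Eventually.of_forall fun x => abs_nonneg _)
          (hm.integral_abs_empiricalEntropy_sub_le hp h h0 h1 hn).1 _

end

end ChainEntropy

theorem theorem2 {Ω A : Type*} [MeasurableSpace Ω] (P : Measure Ω) [IsProbabilityMeasure P]
    [Fintype A] [MeasurableSpace A] [DiscreteMeasurableSpace A]
    (X : ℤ → Ω → A) (hX : ∀ i, Measurable (X i))
    (ν : Measure (ℤ → A)) (hν : ν = P.map (fun ω i => X i ω)) (hstat : IsStationary ν)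
    (hA : ConditionA ν) (hB : ConditionB ν)
    (γ : ℕ → ℝ) (hC : ConditionC ν γ) (hexp : ExponentialDecay γ) (hγ : 0 < γ 0)
    (k : ℕ → ℕ) (hkpos : ∀ n, 0 < k n) (hk : Tendsto k atTop atTop)
    (hklog : limsup (fun n : ℕ => (((k n : ℝ) / Real.log n : ℝ) : EReal)) atTop
      < ((1 / (2 * Real.log (Fintype.card A)) : ℝ) : EReal))
    (q : ℕ → ℝ) (hq : ∀ n, 0 < q n)
    (Y : ℕ → Ω → ℝ)
    (hY : ∀ n ω, Y n ω =
      q n * (1 / (k n : ℝ) * empiricalEntropy (fun i => X i ω) n (k n) - entropyRate ν)) :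
    -- the entropy is well defined, and the series of the `h_i - h` converges
    (Tendsto (fun j : ℕ => entropyH ν j / (j : ℝ)) atTop (𝓝 (entropyRate ν)) ∧
      Tendsto (fun j : ℕ => condEntropy ν j) atTop (𝓝 (entropyRate ν)) ∧
      Summable (fun i : ℕ => condEntropy ν i - entropyRate ν)) ∧
    (Tendsto (fun n => q n / (k n : ℝ)) atTop (𝓝 0) →
      TendstoInMeasure P Y atTop (fun _ => 0)) ∧
    (∀ α : ℝ, 0 < α → Tendsto (fun n => q n / (k n : ℝ)) atTop (𝓝 α) →
      TendstoInMeasure P Y atTop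
        (fun _ => α * ∑' i : ℕ, (condEntropy ν i - entropyRate ν))) ∧
    (Tendsto (fun n => q n / (k n : ℝ)) atTop atTop →
      ∀ r : ℝ, Tendsto (fun n => P {ω | Y n ω < r}) atTop (𝓝 0)) ∧
    -- whatever the scaling, there is no nondegenerate Gaussian limit in distribution
    (∀ (m : ℝ) (v : NNReal), v ≠ 0 →
      ¬ TendstoInDistribution Y atTop (id : ℝ → ℝ) (fun _ => P) (gaussianReal m v)) := by
  have hφ : Measurable fun ω i => X i ω := measurable_pi_lambda _ hX
  have : IsProbabilityMeasure ν := by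
    rw [hν]
    exact Measure.isProbabilityMeasure_map hφ.aemeasurable
  obtain ⟨ω₀⟩ : Nonempty Ω := nonempty_of_isProbabilityMeasure P
  have : Nonempty A := ⟨X 0 ω₀⟩
  have hp := isWordLaw_wordProb hstat hA
  obtain ⟨K, θ, hr, hK, hθ0, hθ1⟩ := exists_hasExpRatio hp hstat hB hC hexp
  have hm : IsMixing ν (contractionRate K θ) := abs_real_inter_sub_le hp hstat hr hK hθ0 hθ1
  obtain ⟨hH, hh, hs, hS⟩ := entropy_convergence hp hstat hB hC hγ hr hK hθ0 hθ1
  have hZ := tendstoInMeasure_empiricalEntropy_sub hX hν hp hstat hm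
    (contractionRate_nonneg hK hθ0) (contractionRate_lt_one hθ1) hkpos hk hklog hs
  -- The factorisation that reduces every claim to the scaling lemmas.
  obtain rfl : Y = fun n ω => q n / (k n : ℝ) *
      (empiricalEntropy (fun i => X i ω) n (k n) - k n * entropyRate ν) := by
    funext n ω
    have hkn : (k n : ℝ) ≠ 0 := by exact_mod_cast (hkpos n).ne'
    rw [hY]
    field_simp
  refine ⟨⟨hH, hh, hs⟩, fun h0 => ?_, fun α _ hα => tendstoInMeasure_mul hZ hα,
    tendsto_measure_mul_lt hZ hS, fun m v hv => not_tendstoInDistribution_gaussian hZ hS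
      (fun n => div_nonneg (hq n).le (Nat.cast_nonneg _)) m hv⟩
  simpa using tendstoInMeasure_mul hZ h0
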